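/- Let $1\le\alpha\le 2$ and let $\chi\in C_0^\infty(\mathbb R)$ satisfy $0\le\chi\le1$, $\chi=1$ on $[-\frac43,\frac43]$ and $\chi(\xi)=0$ for $|\xi|>\frac53$. Let $\mathbb D=\{2^\ell:\ell\in\mathbb N\}$ with $0\in\mathbb N$, put $\varphi_1=\chi$ and $\varphi_N(\xi)=\chi(\xi/N)-\chi(2\xi/N)$ for $N\in\mathbb D\setminus\{1\}$, and let $P_N^x$ be the Fourier multiplier on $L^2(\mathbb R^2)$ with symbol $\varphi_N(\xi)$, where $(\xi,\mu)$ is the frequency dual to $(x,y)$ for the convention $\widehat f(\xi,\mu)=\int_{\mathbb R^2} f(x,y)e^{-i(x\xi+y\mu)}\,dx\,dy$. Let $U(t)=e^{t\partial_x(D_x^\alpha-\partial_{yy})}$, that is, the Fourier multiplier with symbol $e^{it\omega(\xi,\mu)}$, $\omega(\xi,\mu)=\xi(|\xi|^\alpha+\mu^2)$. Then there is a constant $C>0$, depending only on $\alpha$ and $\chi$, such that the following holds. Let $\theta\in[0,1]$, let $p,q\in[1,\infty]$ be given by $\frac1q=\frac{5\theta}{12}$ and $\frac1p=\frac{1-\theta}2$,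 and let $N\in\mathbb D$, where $N\ne1$ if $\theta>0$. Then, for every (complex-valued) $\phi\in L^2(\mathbb R^2)$, $$\|P_N^xU(t)\phi\|_{L^q_t(\mathbb R;L^p_{xy}(\mathbb R^2))}\le C\,N^{-\frac\theta6(\alpha-\frac12)}\|\phi\|_{L^2(\mathbb R^2)}.$$ -/

import Mathlib

open MeasureTheory Set
open scoped ENNReal FourierTransform ContDiff

noncomputable section

/-- The plane `ℝ²` with variables `(x, y)`, and its dual with variables `ζ = (ξ, μ)`. -/
abbrev Plane : Type := EuclideanSpace ℝ (Fin 2)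

/-- The complex space `L²(ℝ²)`. -/
abbrev L2Plane : Type := Lp (α := Plane) ℂ 2 volume

/-- `2π ζ`: Mathlib's Fourier transform has the kernel `exp (-2 π i ⟨z, ζ⟩)`, so that the Mathlib
frequency `ζ` is the frequency `2π ζ` for the convention with kernel `exp (-i ⟨z, ζ⟩)`. -/
def angularFreq (ζ : Plane) : Plane := (2 * Real.pi) • ζ

lemma memLp_symbol {m : Plane → ℂ} (hm : Measurable m) (hb : ∃ C : ℝ, ∀ ζ, ‖m ζ‖ ≤ C) :
    MemLp (fun ζ : Plane => m (angularFreq ζ)) ∞ volume := by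
  obtain ⟨C, hC⟩ := hb
  refine memLp_top_of_bound (Measurable.aestronglyMeasurable ?_) C
    (Filter.Eventually.of_forall fun ζ => hC _)
  exact hm.comp (measurable_id.const_smul (2 * Real.pi))

/-- The Fourier multiplier on `L²(ℝ²)` with the bounded measurable symbol `m`, where the symbol
is a function of the frequency for the convention `∫ f(z) exp (-i ⟨z, ζ⟩) dz`. -/
def fourierMultiplier (m : Plane → ℂ) (hm : Measurable m) (hb : ∃ C : ℝ, ∀ ζ, ‖m ζ‖ ≤ C)
    (f : L2Plane) : L2Plane :=
  𝓕⁻ (((memLp_symbol hm hb).toLp _ • 𝓕 f : L2Plane))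

/-- The dispersion relation `ω(ξ, μ) = ξ (|ξ|^α + μ²)`. -/
def dispersion (α : ℝ) (ζ : Plane) : ℝ := ζ 0 * (|ζ 0| ^ α + ζ 1 ^ 2)

/-- The symbol `exp (i t ω(ξ, μ))` of the free evolution. -/
def evolutionSymbol (α t : ℝ) (ζ : Plane) : ℂ :=
  Complex.exp (Complex.I * ((t * dispersion α ζ : ℝ) : ℂ))

lemma measurable_evolutionSymbol (α t : ℝ) : Measurable (evolutionSymbol α t) := by
  unfold evolutionSymbol dispersion
  fun_prop

lemma bounded_evolutionSymbol (α t : ℝ) : ∃ C : ℝ, ∀ ζ, ‖evolutionSymbol α t ζ‖ ≤ C :=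
  ⟨1, fun ζ => by rw [evolutionSymbol, Complex.norm_exp_I_mul_ofReal]⟩

/-- The free evolution `U(t) = exp (t ∂ₓ (D_x^α - ∂_yy))` on `L²(ℝ²)`. -/
def freeEvolution (α t : ℝ) (f : L2Plane) : L2Plane :=
  fourierMultiplier (evolutionSymbol α t) (measurable_evolutionSymbol α t)
    (bounded_evolutionSymbol α t) f

/-- The dyadic numbers `2^ℓ`, `ℓ = 0, 1, 2, …`. -/
def dyadicNumbers : Set ℝ := Set.range fun l : ℕ => (2 : ℝ) ^ l

/-- The cutoff functions from which the dyadic decomposition is built. -/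
structure IsCutoff (χ : ℝ → ℝ) : Prop where
  smooth : ContDiff ℝ ∞ χ
  nonneg : ∀ ξ, 0 ≤ χ ξ
  le_one : ∀ ξ, χ ξ ≤ 1
  eq_one : ∀ ξ ∈ Icc (-(4 / 3) : ℝ) (4 / 3), χ ξ = 1
  eq_zero : ∀ ξ : ℝ, 5 / 3 < |ξ| → χ ξ = 0

open Classical in
/-- `φ_1 = χ`, and `φ_N(ξ) = χ(ξ / N) - χ(2 ξ / N)` for `N ≠ 1`. -/
def dyadicBump (χ : ℝ → ℝ) (N ξ : ℝ) : ℝ :=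
  if N = 1 then χ ξ else χ (ξ / N) - χ (2 * (ξ / N))

/-- The symbol `φ_N(ξ)`, as a function of `(ξ, μ)`. -/
def projSymbol (χ : ℝ → ℝ) (N : ℝ) (ζ : Plane) : ℂ := (dyadicBump χ N (ζ 0) : ℂ)

lemma IsCutoff.measurable_projSymbol {χ : ℝ → ℝ} (hχ : IsCutoff χ) (N : ℝ) :
    Measurable (projSymbol χ N) := by
  have h := hχ.smooth.continuous.measurable
  unfold projSymbol dyadicBump
  split_ifs <;> fun_prop

lemma IsCutoff.bounded_projSymbol {χ : ℝ → ℝ} (hχ : IsCutoff χ) (N : ℝ) :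
    ∃ C : ℝ, ∀ ζ, ‖projSymbol χ N ζ‖ ≤ C := by
  refine ⟨1, fun ζ => ?_⟩
  rw [projSymbol, Complex.norm_real, Real.norm_eq_abs, dyadicBump, abs_le]
  split_ifs
  · constructor <;> linarith [hχ.nonneg (ζ 0), hχ.le_one (ζ 0)]
  · constructor <;> linarith [hχ.nonneg (ζ 0 / N), hχ.le_one (ζ 0 / N),
      hχ.nonneg (2 * (ζ 0 / N)), hχ.le_one (2 * (ζ 0 / N))]

/-- The frequency localization `P_N^x`, i.e. the Fourier multiplier with symbol `φ_N(ξ)`. -/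
def freqProj {χ : ℝ → ℝ} (hχ : IsCutoff χ) (N : ℝ) (f : L2Plane) : L2Plane :=
  fourierMultiplier (projSymbol χ N) (hχ.measurable_projSymbol N) (hχ.bounded_projSymbol N) f

/-- The norm `‖u‖_{L^q_t L^p_{xy}}` of a time dependent function `u` with values in `L²(ℝ²)`,
as an element of `[0, ∞]`. -/
def mixedNorm (q p : ℝ≥0∞) (u : ℝ → L2Plane) : ℝ≥0∞ :=
  eLpNorm (fun t : ℝ => eLpNorm (u t) p volume) q volume

end

/-! The estimate interpolates between the `L²` bound at `θ = 0` and the endpoint `L^(12/5)_t L^∞` at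
`θ = 1`. The endpoint comes from a dispersive bound and a `TT*` argument.

Dispersive bound. The kernel of `P_N² U(t)` is an integral over `(ξ, μ)`. The `μ`-integral is
Gaussian and contributes a factor of size `|tξ|^(-1/2)` and the phase `-y²/(4tξ)`. With `ξ = ± N η`
the remaining phase is `τ η^(α+1) + X η - β/η`, where `|τ| = |t| N^(α+1)` while `X` and `β` are
arbitrary real numbers. Its second derivative may vanish, but `η³` times it is `τ α (α+1) η^(α+2) -
2β`, which is strictly monotone at a rate comparable to `|τ|` whatever `β` is. Hence the second
derivative is small only near one point, and the second derivative test away from that point gives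
`|τ|^(-1/3)` uniformly in `X` and `β` (`norm_integral_oscExp_kernelPhase_le`). Altogether the kernel
is `O(N (|t| N)^(-1/2) (|t| N^(α+1))^(-1/3))`, that is `O(N^(-(α-1/2)/3) |t|^(-5/6))`
(`IsCutoff.exists_norm_integral_kernelIntegrand_le`, and weakly `IsCutoff.exists_dispersive_bound`).

`TT*`. The `L^∞` norm is a supremum of pairings with countably many Schwartz functions in the unit
ball of `L¹` (`exists_schwartz_seq_eLpNorm_top_le`). Choosing a maximizing index at each time
linearizes the supremum (`lintegral_iSup_inner_rpow_le`). For a single curve `V`, duality reduces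
the bound to a double integral of `⟪V t, V s⟫`, which is controlled by Hardy–Littlewood–Sobolev from
`L^(12/7)` to `L^(12/5)` with kernel `|t-s|^(-5/6)` (`lintegral_lintegral_rieszKernel_le`). The
square root taken in `TT*` halves the power of `N`.

Interpolation is only needed at fixed time, between `L²` and `L^∞` in space. The block `N = 1` is
limited to `θ = 0` because its bump does not vanish near `ξ = 0`. -/

noncomputable section

/-! ### Van der Corput estimates -/

/-- If `F` increases at rate at least `l`, and the integrals of a function of norm at most `1` over
intervals on which `|F| ≥ l * r` are bounded by `K`, the full integral is at most `2 r + 2 K`. -/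
lemma norm_integral_le_of_rate {f : ℝ → ℂ} {F : ℝ → ℝ} {a b l r K : ℝ} (hab : a ≤ b) (hl : 0 ≤ l)
    (hr : 0 < r) (hK : 0 ≤ K) (hf : ContinuousOn f (Icc a b)) (hf1 : ∀ x ∈ Icc a b, ‖f x‖ ≤ 1)
    (hF : ContinuousOn F (Icc a b))
    (hmono : ∀ x ∈ Icc a b, ∀ y ∈ Icc a b, x ≤ y → l * (y - x) ≤ F y - F x)
    (hpos : ∀ s t, a ≤ s → s ≤ t → t ≤ b → (∀ x ∈ Icc s t, l * r ≤ F x) →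
      ‖∫ x in s..t, f x‖ ≤ K)
    (hneg : ∀ s t, a ≤ s → s ≤ t → t ≤ b → (∀ x ∈ Icc s t, F x ≤ -(l * r)) →
      ‖∫ x in s..t, f x‖ ≤ K) :
    ‖∫ x in a..b, f x‖ ≤ 2 * r + 2 * K := by
  -- `c` is a zero of `F`, or the end point nearest to one when `F` keeps a sign. The interval of
  -- radius `r` around `c` is estimated trivially by its length.
  obtain ⟨c, hc, hcl, hcr⟩ : ∃ c ∈ Icc a b, (∀ x ∈ Icc a b, x < c → F x ≤ -(l * (c - x))) ∧
      (∀ x ∈ Icc a b, c < x → l * (x - c) ≤ F x) := by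
    by_cases h1 : 0 ≤ F a
    · refine ⟨a, left_mem_Icc.2 hab, fun x hx h => absurd h (not_lt.2 hx.1), fun x hx _ => ?_⟩
      linarith [hmono a (left_mem_Icc.2 hab) x hx hx.1]
    by_cases h2 : F b ≤ 0
    · refine ⟨b, right_mem_Icc.2 hab, fun x hx _ => ?_, fun x hx h => absurd h (not_lt.2 hx.2)⟩
      linarith [hmono x hx b (right_mem_Icc.2 hab) hx.2]
    obtain ⟨c, hc, hc0⟩ := intermediate_value_Icc hab hF ⟨(not_le.1 h1).le, (not_le.1 h2).le⟩
    refine ⟨c, hc, fun x hx h => ?_, fun x hx h => ?_⟩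
    · linarith [hmono x hx c hc h.le]
    · linarith [hmono c hc x hx h.le]
  have hint : ∀ s t, a ≤ s → s ≤ t → t ≤ b → IntervalIntegrable f volume s t := by
    intro s t h1 h2 h3
    refine ContinuousOn.intervalIntegrable ?_
    rw [uIcc_of_le h2]
    exact hf.mono (Icc_subset_Icc h1 h3)
  obtain ⟨s, hs⟩ : ∃ s, s = max a (c - r) := ⟨_, rfl⟩
  obtain ⟨t, ht⟩ : ∃ t, t = min b (c + r) := ⟨_, rfl⟩
  have has : a ≤ s := hs ▸ le_max_left _ _
  have htb : t ≤ b := ht ▸ min_le_left _ _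
  have hsc : s ≤ c := hs ▸ max_le hc.1 (by linarith)
  have hct : c ≤ t := ht ▸ le_min hc.2 (by linarith)
  have hsr : c - r ≤ s := hs ▸ le_max_right _ _
  have htr : t ≤ c + r := ht ▸ min_le_right _ _
  have e : ∫ x in a..b, f x = (∫ x in a..s, f x) + (∫ x in s..t, f x) + ∫ x in t..b, f x := by
    rw [intervalIntegral.integral_add_adjacent_intervals,
      intervalIntegral.integral_add_adjacent_intervals]
    · exact hint _ _ le_rfl (by linarith) htb
    · exact hint _ _ (by linarith) htb le_rfl
    · exact hint _ _ le_rfl has (by linarith)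
    · exact hint _ _ has (by linarith) htb
  have i1 : ‖∫ x in a..s, f x‖ ≤ K := by
    rcases le_or_gt a (c - r) with h | h
    · rw [max_eq_right h] at hs
      refine hneg _ _ le_rfl has (by linarith) fun x hx => ?_
      have := hcl x ⟨hx.1, by linarith [hx.2, hc.2]⟩ (by linarith [hx.2])
      nlinarith [mul_nonneg hl (sub_nonneg.2 hx.2)]
    · rw [max_eq_left h.le] at hs
      simpa [hs] using hK
  have i3 : ‖∫ x in t..b, f x‖ ≤ K := by
    rcases le_or_gt (c + r) b with h | h
    · rw [min_eq_right h] at ht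
      refine hpos _ _ (by linarith [hc.1]) htb le_rfl fun x hx => ?_
      have := hcr x ⟨by linarith [hx.1, hc.1], hx.2⟩ (by linarith [hx.1])
      nlinarith [mul_nonneg hl (sub_nonneg.2 hx.1)]
    · rw [min_eq_left h.le] at ht
      simpa [ht] using hK
  have i2 : ‖∫ x in s..t, f x‖ ≤ 2 * r := by
    have := intervalIntegral.norm_integral_le_of_norm_le_const (a := s) (b := t) (f := f) (C := 1)
      fun x hx => by
        rw [uIoc_of_le (by linarith)] at hx
        exact hf1 x ⟨by linarith [hx.1], by linarith [hx.2]⟩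
    rw [abs_of_nonneg (by linarith)] at this
    linarith
  rw [e]
  linarith [norm_add₃_le (a := ∫ x in a..s, f x) (b := ∫ x in s..t, f x) (c := ∫ x in t..b, f x)]

/-- The oscillating exponential `exp (i φ)`. -/
def oscExp (φ : ℝ → ℝ) (x : ℝ) : ℂ := Complex.exp (Complex.I * (φ x : ℂ))

lemma norm_oscExp (φ : ℝ → ℝ) (x : ℝ) : ‖oscExp φ x‖ = 1 := by
  rw [oscExp, Complex.norm_exp_I_mul_ofReal]

lemma ContinuousOn.oscExp {φ : ℝ → ℝ} {s : Set ℝ} (h : ContinuousOn φ s) :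
    ContinuousOn (oscExp φ) s := by
  have h' : ContinuousOn (fun x => (φ x : ℂ)) s := Complex.continuous_ofReal.comp_continuousOn h
  exact Complex.continuous_exp.comp_continuousOn (continuousOn_const.mul h')

/-- Reversing the phase conjugates the integral. This reduces concave phases to convex ones and `τ <
0` to `τ > 0`. -/
lemma norm_integral_oscExp_neg (φ : ℝ → ℝ) (a b : ℝ) :
    ‖∫ x in a..b, oscExp (fun x => -φ x) x‖ = ‖∫ x in a..b, oscExp φ x‖ := by
  have : ∀ x, oscExp (fun x => -φ x) x = (starRingEnd ℂ) (oscExp φ x) := fun x => by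
    simp [oscExp, ← Complex.exp_conj]
  simp_rw [this]
  rw [intervalIntegral.intervalIntegral_eq_integral_uIoc,
    intervalIntegral.intervalIntegral_eq_integral_uIoc, integral_conj]
  split_ifs <;> simp

/-- Van der Corput's first derivative test for a phase with increasing derivative. -/
lemma norm_integral_oscExp_le_of_deriv {φ φ₁ φ₂ : ℝ → ℝ} {a b l : ℝ} (hab : a ≤ b) (hl : 0 < l)
    (h1 : ∀ x ∈ Icc a b, HasDerivAt φ (φ₁ x) x) (h2 : ∀ x ∈ Icc a b, HasDerivAt φ₁ (φ₂ x) x)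
    (hc : ContinuousOn φ₂ (Icc a b)) (hpos : ∀ x ∈ Icc a b, 0 ≤ φ₂ x)
    (hbd : (∀ x ∈ Icc a b, l ≤ φ₁ x) ∨ (∀ x ∈ Icc a b, φ₁ x ≤ -l)) :
    ‖∫ x in a..b, oscExp φ x‖ ≤ 3 / l := by
  have habs : ∀ x ∈ Icc a b, l ≤ |φ₁ x| := fun x hx => by
    rcases hbd with h | h
    · exact (h x hx).trans (le_abs_self _)
    · exact (by linarith [h x hx] : l ≤ -φ₁ x).trans (neg_le_abs _)
  have hne : ∀ x ∈ Icc a b, φ₁ x ≠ 0 := fun x hx h => by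
    have := habs x hx; rw [h, abs_zero] at this; linarith
  have c0 : ContinuousOn φ (Icc a b) := fun x hx => (h1 x hx).continuousAt.continuousWithinAt
  have c1 : ContinuousOn φ₁ (Icc a b) := fun x hx => (h2 x hx).continuousAt.continuousWithinAt
  have hE := c0.oscExp
  have hcq : ContinuousOn (fun x => φ₂ x / φ₁ x ^ 2) (Icc a b) :=
    hc.div (c1.pow 2) fun x hx => pow_ne_zero 2 (hne x hx)
  -- the primitive `exp (i φ) / (i φ')`
  have hd : ∀ x ∈ Icc a b, HasDerivAt (fun x => oscExp φ x * (-Complex.I * ((φ₁ x)⁻¹ : ℝ)))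
      (oscExp φ x + oscExp φ x * (Complex.I * ((φ₂ x / φ₁ x ^ 2 : ℝ) : ℂ))) x := by
    intro x hx
    have d0 : HasDerivAt (oscExp φ) (oscExp φ x * (Complex.I * (φ₁ x : ℂ))) x :=
      ((h1 x hx).ofReal_comp.const_mul Complex.I).cexp
    have d1 := ((h2 x hx).inv (hne x hx)).ofReal_comp.const_mul (-Complex.I)
    have := d0.mul d1
    refine this.congr_deriv ?_
    have hz : (φ₁ x : ℂ) ≠ 0 := by exact_mod_cast hne x hx
    simp only [Pi.inv_apply]
    push_cast
    field_simp
    ring_nf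
    simp only [Complex.I_sq]
    ring
  have cR : ContinuousOn (fun x => oscExp φ x * (Complex.I * ((φ₂ x / φ₁ x ^ 2 : ℝ) : ℂ)))
      (Icc a b) :=
    hE.mul (continuousOn_const.mul (Complex.continuous_ofReal.comp_continuousOn hcq))
  have iE : IntervalIntegrable (oscExp φ) volume a b :=
    ContinuousOn.intervalIntegrable (by rwa [uIcc_of_le hab])
  have iR : IntervalIntegrable (fun x => oscExp φ x * (Complex.I * ((φ₂ x / φ₁ x ^ 2 : ℝ) : ℂ)))
      volume a b := ContinuousOn.intervalIntegrable (by rwa [uIcc_of_le hab])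
  have ftc := intervalIntegral.integral_eq_sub_of_hasDerivAt (a := a) (b := b)
    (fun x hx => hd x (by rwa [uIcc_of_le hab] at hx)) (iE.add iR)
  rw [intervalIntegral.integral_add iE iR] at ftc
  have ftc' := intervalIntegral.integral_eq_sub_of_hasDerivAt (a := a) (b := b)
    (f := fun x => -(φ₁ x)⁻¹) (f' := fun x => φ₂ x / φ₁ x ^ 2)
    (fun x hx => by
      rw [uIcc_of_le hab] at hx
      exact ((h2 x hx).inv (hne x hx)).neg.congr_deriv (by ring))
    (ContinuousOn.intervalIntegrable (by rwa [uIcc_of_le hab]))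
  -- Since `φ₂ ≥ 0`, the modulus of the integrand is the exact derivative of `-1/φ₁`, so the
  -- integral telescopes; `φ₁` keeps its sign, so one of the two end point terms can be dropped.
  have hR : ‖∫ x in a..b, oscExp φ x * (Complex.I * ((φ₂ x / φ₁ x ^ 2 : ℝ) : ℂ))‖ ≤ 1 / l := by
    calc _ ≤ ∫ x in a..b, φ₂ x / φ₁ x ^ 2 := by
          refine intervalIntegral.norm_integral_le_of_norm_le hab ?_
            (ContinuousOn.intervalIntegrable (by rwa [uIcc_of_le hab]))
          refine Filter.Eventually.of_forall fun x hx => ?_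
          rw [norm_mul, norm_oscExp, norm_mul, Complex.norm_I, Complex.norm_real, one_mul, one_mul,
            Real.norm_of_nonneg]
          exact div_nonneg (hpos x (Ioc_subset_Icc_self hx)) (sq_nonneg _)
      _ ≤ 1 / l := by
          rw [ftc']
          have ha := left_mem_Icc.2 hab
          have hb := right_mem_Icc.2 hab
          rcases hbd with h | h
          · have h3 : 0 ≤ (φ₁ b)⁻¹ := inv_nonneg.2 (hl.le.trans (h b hb))
            have h4 : (φ₁ a)⁻¹ ≤ 1 / l := by
              rw [one_div]; exact inv_anti₀ hl (h a ha)
            linarith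
          · have h3 : (φ₁ a)⁻¹ ≤ 0 := inv_nonpos.2 (by linarith [h a ha])
            have h4 : -(φ₁ b)⁻¹ ≤ 1 / l := by
              rw [one_div, ← inv_neg]; exact inv_anti₀ hl (by linarith [h b hb])
            linarith
  have hbdy : ∀ x ∈ Icc a b, ‖oscExp φ x * (-Complex.I * ((φ₁ x)⁻¹ : ℝ))‖ ≤ 1 / l := by
    intro x hx
    rw [norm_mul, norm_oscExp, norm_mul, norm_neg, Complex.norm_I, Complex.norm_real, one_mul,
      one_mul, norm_inv, one_div]
    exact inv_anti₀ hl (habs x hx)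
  have hfin := eq_sub_of_add_eq ftc
  rw [hfin]
  have := hbdy a (left_mem_Icc.2 hab)
  have := hbdy b (right_mem_Icc.2 hab)
  calc _ ≤ 1 / l + 1 / l + 1 / l :=
        (norm_sub_le _ _).trans (add_le_add ((norm_sub_le _ _).trans (by linarith)) hR)
    _ = 3 / l := by ring

/-- Van der Corput's second derivative test. -/
lemma norm_integral_oscExp_le_of_deriv2 {φ φ₁ φ₂ : ℝ → ℝ} {a b l : ℝ} (hab : a ≤ b) (hl : 0 < l)
    (h1 : ∀ x ∈ Icc a b, HasDerivAt φ (φ₁ x) x) (h2 : ∀ x ∈ Icc a b, HasDerivAt φ₁ (φ₂ x) x)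
    (hc : ContinuousOn φ₂ (Icc a b)) (hpos : ∀ x ∈ Icc a b, l ≤ φ₂ x) :
    ‖∫ x in a..b, oscExp φ x‖ ≤ 8 / √l := by
  have c0 : ContinuousOn φ (Icc a b) := fun x hx => (h1 x hx).continuousAt.continuousWithinAt
  have c1 : ContinuousOn φ₁ (Icc a b) := fun x hx => (h2 x hx).continuousAt.continuousWithinAt
  have hs : 0 < √l := Real.sqrt_pos.2 hl
  have hlr : l * (√l)⁻¹ = √l := by
    field_simp
    rw [Real.sq_sqrt hl.le]
  have hsub : ∀ s t, a ≤ s → t ≤ b → ∀ x ∈ Icc s t, x ∈ Icc a b := fun s t h h' x hx =>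
    ⟨h.trans hx.1, hx.2.trans h'⟩
  -- The radius `r = l^(-1/2)` balances the trivial bound `2 r` against the first derivative bound
  -- `3/(l r)` on each side.
  have key := norm_integral_le_of_rate (f := oscExp φ) (F := φ₁) (a := a) (b := b) (l := l)
    (r := (√l)⁻¹) (K := 3 / √l) hab hl.le (inv_pos.2 hs) (by positivity) c0.oscExp
    (fun x _ => (norm_oscExp φ x).le) c1 ?_ ?_ ?_
  · refine key.trans (le_of_eq ?_)
    ring
  · intro x hx y hy hxy
    refine Convex.mul_sub_le_image_sub_of_le_deriv (convex_Icc a b) c1 ?_ ?_ x hx y hy hxy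
    · intro z hz
      exact (h2 z (interior_subset hz)).differentiableAt.differentiableWithinAt
    · intro z hz
      rw [(h2 z (interior_subset hz)).deriv]
      exact hpos z (interior_subset hz)
  · intro s t h h' h'' hF
    rw [hlr] at hF
    exact norm_integral_oscExp_le_of_deriv h' hs (fun x hx => h1 x (hsub s t h h'' x hx))
      (fun x hx => h2 x (hsub s t h h'' x hx)) (hc.mono (hsub s t h h''))
      (fun x hx => hl.le.trans (hpos x (hsub s t h h'' x hx))) (Or.inl hF)
  · intro s t h h' h'' hF
    rw [hlr] at hF
    exact norm_integral_oscExp_le_of_deriv h' hs (fun x hx => h1 x (hsub s t h h'' x hx))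
      (fun x hx => h2 x (hsub s t h h'' x hx)) (hc.mono (hsub s t h h''))
      (fun x hx => hl.le.trans (hpos x (hsub s t h h'' x hx))) (Or.inr hF)

/-- Integration against an amplitude vanishing at the right end point. -/
lemma norm_integral_mul_le_of_primitive {A A' : ℝ → ℝ} {f : ℝ → ℂ} {a b K : ℝ} (hab : a ≤ b)
    (hA : ∀ x ∈ Icc a b, HasDerivAt A (A' x) x) (hA' : ContinuousOn A' (Icc a b)) (hb : A b = 0)
    (hf : ContinuousOn f (Icc a b)) (hK : ∀ s ∈ Icc a b, ‖∫ x in a..s, f x‖ ≤ K) :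
    ‖∫ x in a..b, (A x : ℂ) * f x‖ ≤ (∫ x in a..b, |A' x|) * K := by
  have hu := uIcc_of_le hab
  have hfi : IntervalIntegrable f volume a b := ContinuousOn.intervalIntegrable (by rwa [hu])
  have cP : ContinuousOn (fun s => ∫ x in a..s, f x) (Icc a b) := by
    rw [← hu]
    exact intervalIntegral.continuousOn_primitive_interval (by
      rw [hu]; exact hf.integrableOn_Icc)
  have cA : ContinuousOn (fun x => (A x : ℂ)) (Icc a b) :=
    Complex.continuous_ofReal.comp_continuousOn
      fun x hx => (hA x hx).continuousAt.continuousWithinAt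
  have cA' : ContinuousOn (fun x => (A' x : ℂ)) (Icc a b) :=
    Complex.continuous_ofReal.comp_continuousOn hA'
  -- Both boundary terms vanish: at `b` because of the amplitude, at `a` because the primitive
  -- starts there.
  have ibp := intervalIntegral.integral_mul_deriv_eq_deriv_mul_of_hasDeriv_right (a := a) (b := b)
    (u := fun x => (A x : ℂ)) (v := fun s => ∫ x in a..s, f x) (u' := fun x => (A' x : ℂ))
    (v' := f) (by rwa [hu]) (by rwa [hu])
    (fun x hx => by
      rw [min_eq_left hab, max_eq_right hab] at hx
      exact (hA x (Ioo_subset_Icc_self hx)).ofReal_comp.hasDerivWithinAt)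
    (fun x hx => by
      rw [min_eq_left hab, max_eq_right hab] at hx
      have hca : ContinuousAt f x := hf.continuousAt (Icc_mem_nhds hx.1 hx.2)
      refine (intervalIntegral.integral_hasDerivAt_right ?_ ?_ hca).hasDerivWithinAt
      · exact ContinuousOn.intervalIntegrable (by
          rw [uIcc_of_le hx.1.le]; exact hf.mono (Icc_subset_Icc le_rfl hx.2.le))
      · exact (hf.mono Ioo_subset_Icc_self).stronglyMeasurableAtFilter isOpen_Ioo x hx)
    (ContinuousOn.intervalIntegrable (by rwa [hu])) hfi
  rw [ibp, hb]
  simp only [Complex.ofReal_zero, zero_mul, intervalIntegral.integral_same, mul_zero, sub_zero,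
    zero_sub, norm_neg]
  rw [← intervalIntegral.integral_mul_const]
  refine intervalIntegral.norm_integral_le_of_norm_le hab ?_ ?_
  · refine Filter.Eventually.of_forall fun x hx => ?_
    rw [norm_mul, Complex.norm_real, Real.norm_eq_abs]
    exact mul_le_mul_of_nonneg_left (hK x (Ioc_subset_Icc_self hx)) (abs_nonneg _)
  · refine ContinuousOn.intervalIntegrable ?_
    rw [hu]
    exact hA'.abs.mul continuousOn_const

/-! ### The rescaled one-dimensional oscillatory integral -/

/-- The phase `τ η^(α+1) + x η - β / η` which appears after rescaling. -/
def kernelPhase (α τ x β η : ℝ) : ℝ := τ * η ^ (α + 1) + x * η - β / η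

lemma kernelPhase_neg (α τ x β η : ℝ) :
    kernelPhase α (-τ) (-x) (-β) η = -kernelPhase α τ x β η := by
  unfold kernelPhase; ring

lemma hasDerivAt_kernelPhase (α τ x β : ℝ) {η : ℝ} (h : 0 < η) :
    HasDerivAt (kernelPhase α τ x β) (τ * ((α + 1) * η ^ α) + x + β / η ^ 2) η := by
  have h1 := ((Real.hasDerivAt_rpow_const (x := η) (p := α + 1) (Or.inl h.ne')).const_mul τ)
  have h2 := (hasDerivAt_id η).const_mul x
  have h3 := (hasDerivAt_inv h.ne').const_mul β
  have := (h1.add h2).sub h3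
  refine (this.congr_deriv ?_).congr_of_eventuallyEq ?_
  · rw [add_sub_cancel_right]; ring
  · exact Filter.Eventually.of_forall fun y => by simp [kernelPhase, div_eq_mul_inv]

/-- Written as a single fraction over `η³` because `β` enters the numerator only as an additive
constant, so that the rate of growth of the numerator does not see `β`. -/
lemma hasDerivAt_kernelPhase_deriv (α τ x β : ℝ) {η : ℝ} (h : 0 < η) :
    HasDerivAt (fun η => τ * ((α + 1) * η ^ α) + x + β / η ^ 2)
      ((τ * ((α + 1) * α) * η ^ (α + 2) - 2 * β) / η ^ 3) η := by
  have h1 := (((Real.hasDerivAt_rpow_const (x := η) (p := α) (Or.inl h.ne')).const_mul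
    (α + 1)).const_mul τ).add_const x
  have h3 := (((hasDerivAt_pow 2 η).inv (pow_ne_zero 2 h.ne')).const_mul β)
  have := h1.add h3
  refine (this.congr_deriv ?_).congr_of_eventuallyEq ?_
  · have e : η ^ (α + 2) = η ^ (α - 1) * η ^ 3 := by
      rw [← Real.rpow_natCast η 3, ← Real.rpow_add h]; norm_num; ring_nf
    rw [e]
    have := h.ne'
    push_cast
    field_simp
    ring
  · exact Filter.Eventually.of_forall fun y => by simp [div_eq_mul_inv]

/-- The numerator `F` of the second derivative has slope at least `τ/2`, so outside an interval of
radius `r` one has `|F| ≥ τ r / 2` and the second derivative test gives a multiple of `(τ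
r)^(-1/2)`. The parametrization `τ = r⁻³` makes this comparable to `r`. The constant is `66 = 2 + 2
* 32`. -/
lemma norm_integral_oscExp_kernelPhase_le_aux {α r : ℝ} (hα : α ∈ Icc (1 : ℝ) 2) (hr : 0 < r)
    (x β : ℝ) {s : ℝ} (hs : s ∈ Icc (1 / 2 : ℝ) 2) :
    ‖∫ η in (1 / 2)..s, oscExp (kernelPhase α (1 / r ^ 3) x β) η‖ ≤ 66 * r := by
  set τ := 1 / r ^ 3 with hτ
  have hτ0 : 0 < τ := by positivity
  have hpos : ∀ η ∈ Icc (1 / 2) s, 0 < η := fun η h => by linarith [h.1]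
  set F : ℝ → ℝ := fun η => τ * ((α + 1) * α) * η ^ (α + 2) - 2 * β with hFdef
  have cont : ContinuousOn (kernelPhase α τ x β) (Icc (1 / 2) s) := fun η h =>
    (hasDerivAt_kernelPhase α τ x β (hpos η h)).continuousAt.continuousWithinAt
  have hFd : ∀ η ∈ Icc (1 / 2) s,
      HasDerivAt F (τ * ((α + 1) * α) * ((α + 2) * η ^ (α + 2 - 1))) η := fun η h =>
    ((Real.hasDerivAt_rpow_const (x := η) (p := α + 2) (Or.inl (hpos η h).ne')).const_mul
      (τ * ((α + 1) * α))).sub_const (2 * β)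
  have hFc : ContinuousOn F (Icc (1 / 2) s) := fun η h =>
    (hFd η h).continuousAt.continuousWithinAt
  -- The lower bound for the second derivative where `|F| ≥ τ r / 2`; the `8` is the maximum of `η³`
  -- for `η ≤ 2`.
  have hlr : τ / 2 * r / 8 = (1 / (4 * r)) ^ 2 := by
    rw [hτ]; field_simp; norm_num
  have hlr0 : 0 < τ / 2 * r / 8 := by positivity
  have hsq : 8 / √(τ / 2 * r / 8) = 32 * r := by
    rw [hlr, Real.sqrt_sq (by positivity)]; field_simp; norm_num
  have hcube : ∀ η ∈ Icc (1 / 2) s, 0 < η ^ 3 ∧ η ^ 3 ≤ 8 := fun η h => by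
    have h0 := hpos η h
    refine ⟨by positivity, ?_⟩
    calc η ^ 3 ≤ 2 ^ 3 := pow_le_pow_left₀ h0.le (h.2.trans hs.2) 3
      _ = 8 := by norm_num
  have c2 : ContinuousOn (fun η => F η / η ^ 3) (Icc (1 / 2) s) :=
    hFc.div (by fun_prop) fun η h => (hcube η h).1.ne'
  have key := norm_integral_le_of_rate (f := oscExp (kernelPhase α τ x β)) (F := F) (a := 1 / 2)
    (b := s) (l := τ / 2) (r := r) (K := 32 * r) hs.1 (by positivity) hr (by positivity)
    cont.oscExp (fun x _ => (norm_oscExp _ x).le) hFc ?_ ?_ ?_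
  · refine key.trans (le_of_eq ?_)
    ring
  · intro y hy z hz hyz
    refine Convex.mul_sub_le_image_sub_of_le_deriv (convex_Icc (1 / 2) s) hFc ?_ ?_ y hy z hz hyz
    · intro w hw
      exact (hFd w (interior_subset hw)).differentiableAt.differentiableWithinAt
    · intro w hw
      rw [(hFd w (interior_subset hw)).deriv]
      have h0 := hpos w (interior_subset hw)
      -- The worst case is `w = 1/2`, `α = 2`. The slope of `F` is then at least `τ * 2 * (3/8)`,
      -- more than the required `τ/2`.
      have h1 : (1 / 8 : ℝ) ≤ w ^ (α + 2 - 1) := by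
        calc (1 / 8 : ℝ) = (1 / 2) ^ (3 : ℝ) := by norm_num
          _ ≤ (1 / 2) ^ (α + 2 - 1) :=
            Real.rpow_le_rpow_of_exponent_ge (by norm_num) (by norm_num) (by linarith [hα.2])
          _ ≤ w ^ (α + 2 - 1) := Real.rpow_le_rpow (by norm_num) (interior_subset hw).1
            (by linarith [hα.1])
      have h2 : (2 : ℝ) ≤ (α + 1) * α := by nlinarith [hα.1]
      have h3 : (3 : ℝ) / 8 ≤ (α + 2) * w ^ (α + 2 - 1) := by
        calc (3 : ℝ) / 8 = 3 * (1 / 8) := by norm_num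
          _ ≤ _ := mul_le_mul (by linarith [hα.1]) h1 (by norm_num) (by linarith [hα.1])
      have h4 : τ * 2 * (3 / 8) ≤ τ * ((α + 1) * α) * ((α + 2) * w ^ (α + 2 - 1)) :=
        mul_le_mul (mul_le_mul_of_nonneg_left h2 hτ0.le) h3 (by norm_num)
          (mul_nonneg hτ0.le (by linarith))
      linarith
  · intro a b h h' h'' hF
    have hsub : ∀ η ∈ Icc a b, η ∈ Icc (1 / 2) s := fun η hη =>
      ⟨h.trans hη.1, hη.2.trans h''⟩
    rw [← hsq]
    refine norm_integral_oscExp_le_of_deriv2 (φ₂ := fun η => F η / η ^ 3) h' hlr0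
      (fun η hη => hasDerivAt_kernelPhase α τ x β (hpos η (hsub η hη)))
      (fun η hη => hasDerivAt_kernelPhase_deriv α τ x β (hpos η (hsub η hη)))
      (c2.mono hsub) fun η hη => ?_
    have h1 := hcube η (hsub η hη)
    rw [le_div_iff₀ h1.1]
    nlinarith [hF η hη]
  · intro a b h h' h'' hF
    have hsub : ∀ η ∈ Icc a b, η ∈ Icc (1 / 2) s := fun η hη =>
      ⟨h.trans hη.1, hη.2.trans h''⟩
    rw [← hsq, ← norm_integral_oscExp_neg]
    refine norm_integral_oscExp_le_of_deriv2 (φ₂ := fun η => -(F η / η ^ 3)) h' hlr0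
      (fun η hη => (hasDerivAt_kernelPhase α τ x β (hpos η (hsub η hη))).neg)
      (fun η hη => (hasDerivAt_kernelPhase_deriv α τ x β (hpos η (hsub η hη))).neg)
      (c2.mono hsub).neg fun η hη => ?_
    have h1 := hcube η (hsub η hη)
    rw [← neg_div, le_div_iff₀ h1.1]
    nlinarith [hF η hη]

/-- The one-dimensional oscillatory integral decays like `|τ|^(-1/3)`, uniformly in the other
parameters of the phase. -/
lemma norm_integral_oscExp_kernelPhase_le {α τ : ℝ} (hα : α ∈ Icc (1 : ℝ) 2) (hτ : τ ≠ 0)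
    (x β : ℝ) {s : ℝ} (hs : s ∈ Icc (1 / 2 : ℝ) 2) :
    ‖∫ η in (1 / 2)..s, oscExp (kernelPhase α τ x β) η‖ ≤ 66 * |τ| ^ (-(1 / 3) : ℝ) := by
  have habs : 0 < |τ| := abs_pos.2 hτ
  have hr : 0 < |τ| ^ (-(1 / 3) : ℝ) := Real.rpow_pos_of_pos habs _
  have hτr : 1 / (|τ| ^ (-(1 / 3) : ℝ)) ^ 3 = |τ| := by
    rw [← Real.rpow_natCast, ← Real.rpow_mul habs.le, one_div, ← Real.rpow_neg habs.le]
    norm_num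
  rcases lt_or_gt_of_ne hτ with h | h
  · have := norm_integral_oscExp_kernelPhase_le_aux hα hr (-x) (-β) hs
    rw [hτr, abs_of_neg h] at this
    rw [abs_of_neg h, ← norm_integral_oscExp_neg]
    convert this using 5
    exact funext fun η => (kernelPhase_neg α τ x β η).symm
  · have := norm_integral_oscExp_kernelPhase_le_aux hα hr x β hs
    rw [hτr] at this
    rwa [abs_of_pos h] at this ⊢

/-- The oscillatory integral with an amplitude vanishing at the right end point. -/
lemma norm_integral_mul_oscExp_kernelPhase_le {α τ : ℝ} (hα : α ∈ Icc (1 : ℝ) 2) (hτ : τ ≠ 0)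
    (x β : ℝ) {A A' : ℝ → ℝ} (hA : ∀ η ∈ Icc (1 / 2 : ℝ) 2, HasDerivAt A (A' η) η)
    (hA' : ContinuousOn A' (Icc (1 / 2) 2)) (h2 : A 2 = 0) :
    ‖∫ η in (1 / 2)..2, (A η : ℂ) * oscExp (kernelPhase α τ x β) η‖ ≤
      (66 * ∫ η in (1 / 2)..2, |A' η|) * |τ| ^ (-(1 / 3) : ℝ) := by
  have := norm_integral_mul_le_of_primitive (f := oscExp (kernelPhase α τ x β))
    (by norm_num : (1 / 2 : ℝ) ≤ 2) hA hA' h2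
    (ContinuousOn.oscExp fun η hη => (hasDerivAt_kernelPhase α τ x β
      (by linarith [hη.1])).continuousAt.continuousWithinAt)
    (fun s hs => norm_integral_oscExp_kernelPhase_le hα hτ x β hs)
  refine this.trans (le_of_eq ?_)
  ring

/-! ### The Hardy–Littlewood–Sobolev inequality for `|t - s|^(-5/6)` -/

lemma lintegral_comp_abs (f : ℝ → ℝ≥0∞) :
    ∫⁻ x : ℝ, f |x| = 2 * ∫⁻ x in Ioi (0 : ℝ), f x := by
  have h1 : ∫⁻ x in Ioi (0 : ℝ), f |x| = ∫⁻ x in Ioi (0 : ℝ), f x :=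
    setLIntegral_congr_fun measurableSet_Ioi fun x hx => by rw [abs_of_pos hx]
  have h2 : ∫⁻ x in Iio (0 : ℝ), f |x| = ∫⁻ x in Ioi (0 : ℝ), f x := by
    rw [← h1, ← lintegral_indicator measurableSet_Ioi, ← lintegral_indicator measurableSet_Iio,
      ← lintegral_neg_eq_self]
    refine lintegral_congr fun x => ?_
    by_cases h : 0 < x <;> simp [indicator, h]
  rw [← lintegral_add_compl _ (measurableSet_Ioi (a := (0 : ℝ))), compl_Ioi, h1,
    setLIntegral_congr Iio_ae_eq_Iic.symm, h2, two_mul]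

lemma lintegral_abs_rpow_near {R : ℝ} (hR : 0 < R) :
    ∫⁻ s : ℝ, (Iic R).indicator (fun u => ENNReal.ofReal (u ^ (-(5 / 6) : ℝ))) |s| =
      ENNReal.ofReal (12 * R ^ (1 / 6 : ℝ)) := by
  rw [lintegral_comp_abs,
    setLIntegral_indicator measurableSet_Iic, inter_comm, Ioi_inter_Iic]
  have hi := intervalIntegral.intervalIntegrable_rpow' (a := 0) (b := R)
    (by norm_num : (-1 : ℝ) < -(5 / 6))
  rw [intervalIntegrable_iff_integrableOn_Ioc_of_le hR.le] at hi
  rw [← ofReal_integral_eq_lintegral_ofReal hi, ← intervalIntegral.integral_of_le hR.le,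
    integral_rpow (Or.inl (by norm_num)), ← ENNReal.ofReal_ofNat 2,
    ← ENNReal.ofReal_mul (by norm_num)]
  · congr 1
    rw [Real.zero_rpow (by norm_num)]
    norm_num
    ring
  · filter_upwards [ae_restrict_mem measurableSet_Ioc] with x hx
    exact Real.rpow_nonneg hx.1.le _

/-- The exponent `-2` is `-(5/6) * (12/5)`: the far part of the kernel is measured in `L^(12/5)`,
dual to `L^(12/7)`. -/
lemma lintegral_abs_rpow_far {R : ℝ} (hR : 0 < R) :
    ∫⁻ s : ℝ, (Ioi R).indicator (fun u => ENNReal.ofReal (u ^ (-2 : ℝ))) |s| =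
      ENNReal.ofReal (2 / R) := by
  rw [lintegral_comp_abs,
    setLIntegral_indicator measurableSet_Ioi, inter_comm, Ioi_inter_Ioi, sup_eq_right.2 hR.le]
  rw [← ofReal_integral_eq_lintegral_ofReal (integrableOn_Ioi_rpow_of_lt (by norm_num) hR),
    integral_Ioi_rpow_of_lt (by norm_num) hR, ← ENNReal.ofReal_ofNat 2,
    ← ENNReal.ofReal_mul (by norm_num)]
  · congr 1
    have : R ^ (-2 + 1 : ℝ) = R⁻¹ := by
      rw [← Real.rpow_neg_one]; norm_num
    rw [this]
    norm_num
    ring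
  · filter_upwards [ae_restrict_mem measurableSet_Ioi] with x hx
    exact Real.rpow_nonneg (hR.le.trans (le_of_lt hx)) _

/-- The kernel `|s|^(-5/6)`. -/
def rieszKernel (s : ℝ) : ℝ≥0∞ := ENNReal.ofReal (|s| ^ (-(5 / 6) : ℝ))

@[fun_prop]
lemma measurable_rieszKernel : Measurable rieszKernel := by
  unfold rieszKernel; fun_prop

lemma rieszKernel_sub_comm (s t : ℝ) : rieszKernel (s - t) = rieszKernel (t - s) := by
  rw [rieszKernel, abs_sub_comm, rieszKernel]

/-- The Riesz potential of the part of `w` below the height `W`. -/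
lemma lintegral_truncation_mul_rieszKernel_le {w : ℝ → ℝ≥0∞} (hw : Measurable w) (W : ℝ≥0∞) (t : ℝ)
    {R : ℝ} (hR : 0 < R) :
    ∫⁻ s, {s | w s ≤ W}.indicator w s * rieszKernel (t - s) ≤
      W * ENNReal.ofReal (12 * R ^ (1 / 6 : ℝ)) +
        (∫⁻ s, w s ^ (12 / 7 : ℝ)) ^ (7 / 12 : ℝ) * ENNReal.ofReal (2 / R) ^ (5 / 12 : ℝ) := by
  set k₁ : ℝ → ℝ≥0∞ := (Iic R).indicator (fun u => ENNReal.ofReal (u ^ (-(5 / 6) : ℝ))) with hk1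
  set k₂ : ℝ → ℝ≥0∞ := (Ioi R).indicator (fun u => ENNReal.ofReal (u ^ (-(5 / 6) : ℝ))) with hk2
  have m1 : Measurable k₁ := by fun_prop (disch := exact measurableSet_Iic)
  have m2 : Measurable k₂ := by fun_prop (disch := exact measurableSet_Ioi)
  -- Near `t` the truncation is bounded by its height `W`; far from `t` it is bounded by `w`, to
  -- which Hölder applies.
  have hsplit : ∀ s, {s | w s ≤ W}.indicator w s * rieszKernel (t - s) ≤
      W * k₁ |t - s| + w s * k₂ |t - s| := by
    intro s
    have hle : {s | w s ≤ W}.indicator w s ≤ W ∧ {s | w s ≤ W}.indicator w s ≤ w s := by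
      by_cases h : w s ≤ W <;> simp [indicator, h]
    by_cases h : |t - s| ≤ R
    · have : k₁ |t - s| = rieszKernel (t - s) := indicator_of_mem (mem_Iic.2 h) _
      rw [this]
      exact (mul_le_mul_left hle.1 _).trans le_self_add
    · have : k₂ |t - s| = rieszKernel (t - s) := indicator_of_mem (mem_Ioi.2 (not_le.1 h)) _
      rw [this]
      exact (mul_le_mul_left hle.2 _).trans le_add_self
  calc _ ≤ ∫⁻ s, (W * k₁ |t - s| + w s * k₂ |t - s|) := lintegral_mono hsplit
    _ = W * (∫⁻ s, k₁ |t - s|) + ∫⁻ s, w s * k₂ |t - s| := by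
        rw [lintegral_add_left (by fun_prop), lintegral_const_mul _ (by fun_prop)]
    _ ≤ _ := by
        gcongr
        · rw [lintegral_sub_left_eq_self (fun s => k₁ |s|) t, lintegral_abs_rpow_near hR]
        · have hold := ENNReal.lintegral_mul_le_Lp_mul_Lq volume
            (p := 12 / 7) (q := 12 / 5) (f := w) (g := fun s => k₂ |t - s|)
            (by rw [Real.holderConjugate_iff]; norm_num) hw.aemeasurable
            (Measurable.aemeasurable (by fun_prop))
          refine hold.trans (le_of_eq ?_)
          have e : ∀ s, k₂ |t - s| ^ (12 / 5 : ℝ) =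
              (Ioi R).indicator (fun u => ENNReal.ofReal (u ^ (-2 : ℝ))) |t - s| := by
            intro s
            by_cases h : R < |t - s|
            · have h0 : 0 < |t - s| := hR.trans h
              rw [hk2, indicator_of_mem (mem_Ioi.2 h), indicator_of_mem (mem_Ioi.2 h),
                ENNReal.ofReal_rpow_of_nonneg (Real.rpow_nonneg h0.le _) (by norm_num),
                ← Real.rpow_mul h0.le]
              norm_num
            · rw [hk2, indicator_of_notMem (by simpa using h), indicator_of_notMem (by simpa using h),
                ENNReal.zero_rpow_of_pos (by norm_num)]
          simp_rw [e]
          rw [lintegral_sub_left_eq_self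
            (fun s => (Ioi R).indicator (fun u => ENNReal.ofReal (u ^ (-2 : ℝ))) |s|) t,
            lintegral_abs_rpow_far hR]
          norm_num

/-- The optimized bound for the Riesz potential of a truncation. -/
lemma mul_lintegral_truncation_mul_rieszKernel_le {w : ℝ → ℝ≥0∞} (hw : Measurable w) (t : ℝ)
    (hwt : w t ≠ ⊤) (hP : ∫⁻ s, w s ^ (12 / 7 : ℝ) ≠ ⊤) (hP0 : ∫⁻ s, w s ^ (12 / 7 : ℝ) ≠ 0) :
    w t * ∫⁻ s, {s | w s ≤ w t}.indicator w s * rieszKernel (t - s) ≤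
      14 * (w t ^ (12 / 7 : ℝ) * (∫⁻ s, w s ^ (12 / 7 : ℝ)) ^ (1 / 6 : ℝ)) := by
  set P := ∫⁻ s, w s ^ (12 / 7 : ℝ) with hPdef
  rcases eq_or_ne (w t) 0 with h0 | h0
  · simp [h0]
  obtain ⟨a, ha0, ha⟩ : ∃ a : ℝ, 0 < a ∧ w t = ENNReal.ofReal a :=
    ⟨(w t).toReal, ENNReal.toReal_pos h0 hwt, (ENNReal.ofReal_toReal hwt).symm⟩
  obtain ⟨p, hp0, hp⟩ : ∃ p : ℝ, 0 < p ∧ P = ENNReal.ofReal p :=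
    ⟨P.toReal, ENNReal.toReal_pos hP0 hP, (ENNReal.ofReal_toReal hP).symm⟩
  -- This radius solves `a R^(1/6) = p^(7/12) R^(-5/12)`, so the near and far contributions have the
  -- same size.
  have hR : 0 < p * a ^ (-(12 / 7) : ℝ) := by positivity
  have key := lintegral_truncation_mul_rieszKernel_le hw (w t) t hR
  rw [← hPdef, hp, ha] at key
  rw [hp, ha]
  refine (mul_le_mul_right key _).trans ?_
  have e1 : a * (p * a ^ (-(12 / 7) : ℝ)) ^ (1 / 6 : ℝ) = a ^ (5 / 7 : ℝ) * p ^ (1 / 6 : ℝ) := by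
    rw [Real.mul_rpow hp0.le (by positivity), ← Real.rpow_mul ha0.le, mul_left_comm,
      mul_comm (a ^ (5 / 7 : ℝ))]
    congr 1
    rw [← Real.rpow_one_add' ha0.le (by norm_num)]
    norm_num
  have e2 : p ^ (7 / 12 : ℝ) * (2 / (p * a ^ (-(12 / 7) : ℝ))) ^ (5 / 12 : ℝ) ≤
      2 * (a ^ (5 / 7 : ℝ) * p ^ (1 / 6 : ℝ)) := by
    rw [Real.div_rpow (by norm_num) (by positivity), Real.mul_rpow hp0.le (by positivity),
      ← Real.rpow_mul ha0.le, div_eq_mul_inv ((2 : ℝ) ^ (5 / 12 : ℝ)), mul_inv, ← Real.rpow_neg hp0.le,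
      ← Real.rpow_neg ha0.le]
    have e3 : p ^ (7 / 12 : ℝ) * p ^ (-(5 / 12) : ℝ) = p ^ (1 / 6 : ℝ) := by
      rw [← Real.rpow_add hp0]; norm_num
    have e4 : (2 : ℝ) ^ (5 / 12 : ℝ) ≤ 2 := by
      calc (2 : ℝ) ^ (5 / 12 : ℝ) ≤ 2 ^ (1 : ℝ) :=
            Real.rpow_le_rpow_of_exponent_le (by norm_num) (by norm_num)
        _ = 2 := Real.rpow_one 2
    have e5 : a ^ (-(-(12 / 7) * (5 / 12)) : ℝ) = a ^ (5 / 7 : ℝ) := by norm_num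
    rw [e5]
    calc _ = 2 ^ (5 / 12 : ℝ) * (a ^ (5 / 7 : ℝ) * (p ^ (7 / 12 : ℝ) * p ^ (-(5 / 12) : ℝ))) := by
          ring
      _ ≤ _ := by rw [e3]; gcongr
  have hfin : a * (a * (12 * (p * a ^ (-(12 / 7) : ℝ)) ^ (1 / 6 : ℝ)) +
      p ^ (7 / 12 : ℝ) * (2 / (p * a ^ (-(12 / 7) : ℝ))) ^ (5 / 12 : ℝ)) ≤
      14 * (a ^ (12 / 7 : ℝ) * p ^ (1 / 6 : ℝ)) := by
    have e6 : a ^ (12 / 7 : ℝ) = a * a ^ (5 / 7 : ℝ) := by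
      rw [← Real.rpow_one_add' ha0.le (by norm_num)]; norm_num
    calc _ ≤ a * (12 * (a ^ (5 / 7 : ℝ) * p ^ (1 / 6 : ℝ)) +
          2 * (a ^ (5 / 7 : ℝ) * p ^ (1 / 6 : ℝ))) := by
          refine mul_le_mul_of_nonneg_left (add_le_add (le_of_eq ?_) e2) ha0.le
          rw [← e1]; ring
      _ = _ := by rw [e6]; ring
  rw [ENNReal.ofReal_rpow_of_nonneg hp0.le (by norm_num),
    ENNReal.ofReal_rpow_of_nonneg (by positivity) (by norm_num),
    ENNReal.ofReal_rpow_of_nonneg ha0.le (by norm_num),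
    ENNReal.ofReal_rpow_of_nonneg hp0.le (by norm_num),
    ← ENNReal.ofReal_mul ha0.le, ← ENNReal.ofReal_mul (by positivity),
    ← ENNReal.ofReal_add (by positivity) (by positivity), ← ENNReal.ofReal_mul ha0.le,
    ← ENNReal.ofReal_mul (by positivity), ← ENNReal.ofReal_ofNat 14,
    ← ENNReal.ofReal_mul (by norm_num)]
  exact ENNReal.ofReal_le_ofReal hfin

/-- The Hardy–Littlewood–Sobolev inequality on the diagonal, for the kernel `|t - s|^(-5/6)`. -/
lemma lintegral_lintegral_rieszKernel_le {w : ℝ → ℝ≥0∞} (hw : Measurable w) (hfin : ∀ t, w t ≠ ⊤) :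
    ∫⁻ t, ∫⁻ s, w t * w s * rieszKernel (t - s) ≤
      28 * (∫⁻ s, w s ^ (12 / 7 : ℝ)) ^ (7 / 6 : ℝ) := by
  set P := ∫⁻ s, w s ^ (12 / 7 : ℝ) with hPdef
  rcases eq_or_ne P ⊤ with hP | hP
  · rw [hP, ENNReal.top_rpow_of_pos (by norm_num), ENNReal.mul_top (by norm_num)]
    exact le_top
  rcases eq_or_ne P 0 with hP0 | hP0
  · have hw0 : w =ᵐ[volume] 0 := by
      rw [hPdef, lintegral_eq_zero_iff (by fun_prop)] at hP0
      filter_upwards [hP0] with t ht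
      have h7 : ¬ (12 / 7 : ℝ) < 0 := by norm_num
      simpa [h7] using ht
    have : ∫⁻ t, ∫⁻ s, w t * w s * rieszKernel (t - s) = 0 := by
      rw [lintegral_eq_zero_iff (by fun_prop)]
      filter_upwards [hw0] with t ht
      simp [ht]
    rw [this]
    exact zero_le
  -- By symmetry of the kernel it suffices to integrate over `w s ≤ w t`, at the cost of a factor 2.
  -- There the inner potential is bounded pointwise, and no maximal function or weak-type
  -- interpolation is needed.
  set T : ℝ → ℝ → ℝ≥0∞ := fun t s => {s | w s ≤ w t}.indicator w s with hT
  have mT : Measurable (Function.uncurry T) := by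
    have hs : MeasurableSet {z : ℝ × ℝ | w z.2 ≤ w z.1} :=
      measurableSet_le (hw.comp measurable_snd) (hw.comp measurable_fst)
    have e : Function.uncurry T = {z : ℝ × ℝ | w z.2 ≤ w z.1}.indicator (fun z => w z.2) := by
      ext ⟨t, s⟩; simp [T, Function.uncurry, indicator]
    rw [e]
    exact (hw.comp measurable_snd).indicator hs
  have mG : Measurable (fun z : ℝ × ℝ => w z.1 * T z.1 z.2 * rieszKernel (z.1 - z.2)) :=
    ((hw.comp measurable_fst).mul mT).mul (by fun_prop)
  have hpt : ∀ t s, w t * w s * rieszKernel (t - s) ≤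
      w t * T t s * rieszKernel (t - s) + w s * T s t * rieszKernel (s - t) := by
    intro t s
    rcases le_total (w s) (w t) with h | h
    · have : T t s = w s := indicator_of_mem (by exact h) _
      rw [this]; exact le_self_add
    · have : T s t = w t := indicator_of_mem (by exact h) _
      rw [this, rieszKernel_sub_comm t s, mul_comm (w t)]; exact le_add_self
  have hswap : ∫⁻ t, ∫⁻ s, w s * T s t * rieszKernel (s - t) =
      ∫⁻ t, ∫⁻ s, w t * T t s * rieszKernel (t - s) :=
    lintegral_lintegral_swap (f := fun t s => w s * T s t * rieszKernel (s - t))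
      (mG.comp measurable_swap).aemeasurable
  have hmain : ∫⁻ t, ∫⁻ s, w t * T t s * rieszKernel (t - s) ≤ 14 * P ^ (7 / 6 : ℝ) := by
    calc _ ≤ ∫⁻ t, 14 * (w t ^ (12 / 7 : ℝ) * P ^ (1 / 6 : ℝ)) := by
          refine lintegral_mono fun t => ?_
          simp_rw [mul_assoc]
          rw [lintegral_const_mul _ (by
            have m2 : Measurable (T t) := mT.comp (measurable_prodMk_left (x := t))
            exact m2.mul (by fun_prop))]
          exact mul_lintegral_truncation_mul_rieszKernel_le hw t (hfin t) hP hP0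
      _ = 14 * (P * P ^ (1 / 6 : ℝ)) := by
          rw [lintegral_const_mul _ (by fun_prop), lintegral_mul_const _ (by fun_prop)]
      _ = _ := by
          congr 1
          nth_rewrite 1 [← ENNReal.rpow_one P]
          rw [← ENNReal.rpow_add _ _ hP0 hP]
          norm_num
  calc _ ≤ ∫⁻ t, ∫⁻ s, (w t * T t s * rieszKernel (t - s) + w s * T s t * rieszKernel (s - t)) :=
        lintegral_mono fun t => lintegral_mono fun s => hpt t s
    _ = (∫⁻ t, ∫⁻ s, w t * T t s * rieszKernel (t - s)) +
        ∫⁻ t, ∫⁻ s, w s * T s t * rieszKernel (s - t) := by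
        rw [← lintegral_add_left mG.lintegral_prod_right']
        refine lintegral_congr fun t => ?_
        exact lintegral_add_left (mG.comp (measurable_prodMk_left (x := t))) _
    _ ≤ 14 * P ^ (7 / 6 : ℝ) + 14 * P ^ (7 / 6 : ℝ) := by
        rw [hswap]; exact add_le_add hmain hmain
    _ = _ := by rw [← add_mul]; norm_num

/-! ### The `TT*` argument in an abstract Hilbert space -/

section TTStar

variable {H : Type*} [NormedAddCommGroup H] [InnerProductSpace ℂ H] [CompleteSpace H]

/-- The square of the norm is expanded as a double integral of inner products: this is the `TT*`
identity, with absolute values taken inside. -/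
lemma enorm_integral_sq_le_lintegral_inner {G : ℝ → H} (hG : Integrable G) :
    ‖∫ t, G t‖ₑ ^ 2 ≤ ∫⁻ t, ∫⁻ s, ‖inner ℂ (G t) (G s)‖ₑ := by
  have h1 : ∀ g : H, ‖inner ℂ (∫ t, G t) g‖ₑ ≤ ∫⁻ t, ‖inner ℂ g (G t)‖ₑ := by
    intro g
    rw [← inner_conj_symm, ← integral_inner hG g]
    refine le_trans (le_of_eq ?_) (enorm_integral_le_lintegral_enorm _)
    simp [enorm_eq_nnnorm]
  have h2 : ‖∫ t, G t‖ₑ ^ 2 = ‖inner ℂ (∫ t, G t) (∫ t, G t)‖ₑ := by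
    rw [inner_self_eq_norm_sq_to_K, enorm_pow]
    congr 1
    simp [enorm_eq_nnnorm]
  rw [h2, ← integral_inner hG]
  refine (enorm_integral_le_lintegral_enorm _).trans (lintegral_mono fun t => ?_)
  exact h1 (G t)

/-- The truncated form of the Strichartz estimate below. -/
lemma setLIntegral_inner_rpow_le {V : ℝ → H} (hV : StronglyMeasurable V) {B : ℝ}
    (hB : ∀ t, ‖V t‖ ≤ B) {D : ℝ≥0∞}
    (hD : ∀ t s, t ≠ s → ‖inner ℂ (V t) (V s)‖ₑ ≤ D * rieszKernel (t - s)) (f : H)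
    {S : Set ℝ} (hS : MeasurableSet S) (hSfin : volume S ≠ ⊤) :
    (∫⁻ t in S, ‖inner ℂ (V t) f‖ₑ ^ (12 / 5 : ℝ)) ^ (5 / 12 : ℝ) ≤
      (28 * D) ^ (1 / 2 : ℝ) * ‖f‖ₑ := by
  set c : ℝ → ℂ := fun t => inner ℂ (V t) f with hc
  have mc : StronglyMeasurable c := hV.inner stronglyMeasurable_const
  -- The extremizer in the duality between `L^(12/5)` and `L^(12/7)`: pairing `G t` with `f` gives
  -- exactly `|c t|^(12/5)` on `S`. Finite measure of `S` and boundedness of `V` make `G`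
  -- integrable.
  set G : ℝ → H := S.indicator fun t => (((‖c t‖ ^ (2 / 5 : ℝ) : ℝ) : ℂ) * c t) • V t with hGdef
  set A := ∫⁻ t in S, ‖c t‖ₑ ^ (12 / 5 : ℝ) with hA
  have hB0 : 0 ≤ B := (norm_nonneg _).trans (hB 0)
  have hcB : ∀ t, ‖c t‖ ≤ B * ‖f‖ := fun t =>
    (norm_inner_le_norm _ _).trans (mul_le_mul_of_nonneg_right (hB t) (norm_nonneg _))
  have hGi : Integrable G := by
    rw [hGdef, integrable_indicator_iff hS]
    refine Measure.integrableOn_of_bounded (M := ((B * ‖f‖) ^ (2 / 5 : ℝ) * (B * ‖f‖)) * B) hSfin ?_ ?_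
    · have m1 : Measurable fun t => ((‖c t‖ ^ (2 / 5 : ℝ) : ℝ) : ℂ) :=
        Complex.measurable_ofReal.comp (mc.measurable.norm.pow_const _)
      exact ((m1.stronglyMeasurable.mul mc).smul hV).aestronglyMeasurable
    · refine Filter.Eventually.of_forall fun t => ?_
      rw [norm_smul, norm_mul, Complex.norm_real,
        Real.norm_of_nonneg (Real.rpow_nonneg (norm_nonneg _) _)]
      have := hcB t
      have := hB t
      gcongr
  have hnorm : ∀ t, ‖inner ℂ (G t) f‖ₑ = S.indicator (fun t => ‖c t‖ₑ ^ (12 / 5 : ℝ)) t := by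
    intro t
    by_cases ht : t ∈ S
    · rw [hGdef, indicator_of_mem ht, indicator_of_mem ht, inner_smul_left, enorm_mul]
      rw [← ofReal_norm, ← ofReal_norm, ← ENNReal.ofReal_mul (norm_nonneg _),
        ENNReal.ofReal_rpow_of_nonneg (norm_nonneg _) (by norm_num)]
      congr 1
      rw [RCLike.norm_conj, norm_mul, Complex.norm_real,
        Real.norm_of_nonneg (Real.rpow_nonneg (norm_nonneg _) _), mul_assoc]
      change ‖c t‖ ^ (2 / 5 : ℝ) * (‖c t‖ * ‖c t‖) = _
      rw [← pow_two, ← Real.rpow_natCast, ← Real.rpow_add_of_nonneg (norm_nonneg _) (by norm_num)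
        (by norm_num)]
      norm_num
      rfl
    · rw [hGdef, indicator_of_notMem ht, indicator_of_notMem ht, inner_zero_left, enorm_zero]
  have hreal : ∀ t, inner ℂ (G t) f = ((‖inner ℂ (G t) f‖ : ℝ) : ℂ) := by
    intro t
    by_cases ht : t ∈ S
    · have : inner ℂ (G t) f = ((‖c t‖ ^ (2 / 5 : ℝ) * ‖c t‖ ^ 2 : ℝ) : ℂ) := by
        rw [hGdef, indicator_of_mem ht, inner_smul_left, map_mul, Complex.conj_ofReal, mul_assoc]
        change _ * ((starRingEnd ℂ) (c t) * c t) = _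
        rw [Complex.conj_mul']
        push_cast; rfl
      rw [this, Complex.norm_real, Real.norm_of_nonneg (by positivity)]
    · rw [hGdef, indicator_of_notMem ht, inner_zero_left]; simp
  -- Finiteness is what permits the final division by `A^(7/12)`, and is the reason for the
  -- truncation to `S`.
  have hAfin : A ≠ ⊤ := by
    have : ∫⁻ t, ‖inner ℂ (G t) f‖ₑ = A := by
      simp_rw [hnorm]; rw [lintegral_indicator hS]
    rw [← this]
    exact (hGi.inner_const f).2.ne
  have hAeq : A ≤ ‖∫ t, G t‖ₑ * ‖f‖ₑ := by
    have h1 : A = ‖∫ t, inner ℂ (G t) f‖ₑ := by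
      rw [integral_congr_ae (Filter.Eventually.of_forall hreal)]
      rw [integral_complex_ofReal]
      rw [← ofReal_norm, Complex.norm_real,
        Real.norm_of_nonneg (integral_nonneg fun t => norm_nonneg _),
        ofReal_integral_norm_eq_lintegral_enorm (hGi.inner_const f)]
      simp_rw [hnorm]
      rw [lintegral_indicator hS]
    have h2 : ∫ t, inner ℂ (G t) f = (starRingEnd ℂ) (inner ℂ f (∫ t, G t)) := by
      rw [← integral_inner hGi f, ← integral_conj]
      simp
    rw [h1, h2, inner_conj_symm, ← ofReal_norm, ← ofReal_norm, ← ofReal_norm,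
      ← ENNReal.ofReal_mul (norm_nonneg _)]
    exact ENNReal.ofReal_le_ofReal (norm_inner_le_norm _ _)
  set w : ℝ → ℝ≥0∞ := S.indicator fun t => ‖c t‖ₑ ^ (7 / 5 : ℝ) with hw
  have mw : Measurable w := (mc.measurable.enorm.pow_const _).indicator hS
  have hwP : ∫⁻ s, w s ^ (12 / 7 : ℝ) = A := by
    rw [hA, ← lintegral_indicator hS]
    refine lintegral_congr fun s => ?_
    by_cases hs : s ∈ S
    · rw [hw, indicator_of_mem hs, indicator_of_mem hs, ← ENNReal.rpow_mul]; norm_num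
    · rw [hw, indicator_of_notMem hs, indicator_of_notMem hs, ENNReal.zero_rpow_of_pos (by norm_num)]
  have hwfin : ∀ t, w t ≠ ⊤ := by
    intro t
    by_cases ht : t ∈ S
    · rw [hw, indicator_of_mem ht]
      exact ENNReal.rpow_ne_top_of_nonneg (by norm_num) enorm_ne_top
    · rw [hw, indicator_of_notMem ht]; exact ENNReal.zero_ne_top
  have hGG : ∀ t s, t ≠ s → ‖inner ℂ (G t) (G s)‖ₑ ≤ D * (w t * w s * rieszKernel (t - s)) := by
    intro t s hts
    by_cases ht : t ∈ S
    swap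
    · simp [hGdef, indicator_of_notMem ht]
    by_cases hs : s ∈ S
    swap
    · simp [hGdef, indicator_of_notMem hs]
    have hone : ∀ z : ℂ, ‖((‖z‖ ^ (2 / 5 : ℝ) : ℝ) : ℂ) * z‖ₑ = ‖z‖ₑ ^ (7 / 5 : ℝ) := by
      intro z
      rw [← ofReal_norm, ← ofReal_norm, ENNReal.ofReal_rpow_of_nonneg (norm_nonneg _) (by norm_num),
        norm_mul, Complex.norm_real, Real.norm_of_nonneg (Real.rpow_nonneg (norm_nonneg _) _)]
      congr 1
      rw [← Real.rpow_add_one' (norm_nonneg _) (by norm_num)]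
      norm_num
    rw [hGdef, hw, indicator_of_mem ht, indicator_of_mem hs, indicator_of_mem ht,
      indicator_of_mem hs, inner_smul_left, inner_smul_right, enorm_mul, enorm_mul, RCLike.enorm_conj,
      hone, hone]
    calc _ ≤ ‖c t‖ₑ ^ (7 / 5 : ℝ) * (‖c s‖ₑ ^ (7 / 5 : ℝ) * (D * rieszKernel (t - s))) := by
          gcongr; exact hD t s hts
      _ = _ := by ring
  have hsq : ‖∫ t, G t‖ₑ ^ 2 ≤ 28 * D * A ^ (7 / 6 : ℝ) := by
    calc _ ≤ ∫⁻ t, ∫⁻ s, ‖inner ℂ (G t) (G s)‖ₑ := enorm_integral_sq_le_lintegral_inner hGi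
      _ ≤ ∫⁻ t, ∫⁻ s, D * (w t * w s * rieszKernel (t - s)) := by
          refine lintegral_mono fun t => lintegral_mono_ae ?_
          -- The decay hypothesis says nothing on the diagonal `s = t`, which is a null set.
          filter_upwards [compl_mem_ae_iff.2 (measure_singleton (μ := volume) t)] with s hs
          exact hGG t s (fun h => hs h.symm)
      _ = D * ∫⁻ t, ∫⁻ s, w t * w s * rieszKernel (t - s) := by
          have m3 : Measurable fun z : ℝ × ℝ => w z.1 * w z.2 * rieszKernel (z.1 - z.2) := by
            fun_prop
          rw [← lintegral_const_mul _ m3.lintegral_prod_right']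
          refine lintegral_congr fun t => ?_
          exact lintegral_const_mul _ (m3.comp (measurable_prodMk_left (x := t)))
      _ ≤ D * (28 * A ^ (7 / 6 : ℝ)) := by
          gcongr
          have := lintegral_lintegral_rieszKernel_le mw hwfin
          rwa [hwP] at this
      _ = _ := by ring
  have hroot : ‖∫ t, G t‖ₑ ≤ (28 * D) ^ (1 / 2 : ℝ) * A ^ (7 / 12 : ℝ) := by
    have h := ENNReal.rpow_le_rpow hsq (by norm_num : (0 : ℝ) ≤ 1 / 2)
    rw [← ENNReal.rpow_natCast, ← ENNReal.rpow_mul, ENNReal.mul_rpow_of_nonneg _ _ (by norm_num),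
      ← ENNReal.rpow_mul] at h
    norm_num at h
    norm_num
    exact h
  rcases eq_or_ne A 0 with hA0 | hA0
  · rw [hA0, ENNReal.zero_rpow_of_pos (by norm_num)]; exact zero_le
  have hAA : A ≤ ((28 * D) ^ (1 / 2 : ℝ) * ‖f‖ₑ) * A ^ (7 / 12 : ℝ) :=
    hAeq.trans ((mul_le_mul_left hroot _).trans (le_of_eq (by ring)))
  calc A ^ (5 / 12 : ℝ) = A * A ^ (-(7 / 12) : ℝ) := by
        nth_rewrite 2 [← ENNReal.rpow_one A]
        rw [← ENNReal.rpow_add _ _ hA0 hAfin]; norm_num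
    _ ≤ (((28 * D) ^ (1 / 2 : ℝ) * ‖f‖ₑ) * A ^ (7 / 12 : ℝ)) * A ^ (-(7 / 12) : ℝ) :=
        mul_le_mul_left hAA _
    _ = _ := by
        rw [mul_assoc _ (A ^ (7 / 12 : ℝ)), ← ENNReal.rpow_add _ _ hA0 hAfin]
        norm_num

/-- A Strichartz estimate: `|⟪V t, V s⟫| ≤ D |t - s|^(-5/6)` implies that `t ↦ ⟪V t, f⟫` belongs to
`L^(12/5)`. -/
lemma lintegral_inner_rpow_le {V : ℝ → H} (hV : StronglyMeasurable V) {B : ℝ}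
    (hB : ∀ t, ‖V t‖ ≤ B) {D : ℝ≥0∞}
    (hD : ∀ t s, t ≠ s → ‖inner ℂ (V t) (V s)‖ₑ ≤ D * rieszKernel (t - s)) (f : H) :
    ∫⁻ t, ‖inner ℂ (V t) f‖ₑ ^ (12 / 5 : ℝ) ≤
      ((28 * D) ^ (1 / 2 : ℝ) * ‖f‖ₑ) ^ (12 / 5 : ℝ) := by
  have hU : (⋃ n : ℕ, Icc (-(n : ℝ)) n) = univ := by
    refine eq_univ_of_forall fun x => mem_iUnion.2 ?_
    obtain ⟨n, hn⟩ := exists_nat_ge |x|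
    exact ⟨n, abs_le.1 hn⟩
  have hdir : Directed (· ⊆ ·) fun n : ℕ => Icc (-(n : ℝ)) n := by
    refine Monotone.directed_le fun m n h => Icc_subset_Icc ?_ ?_ <;> simp [h]
  rw [← setLIntegral_univ, ← hU, setLIntegral_iUnion_of_directed _ hdir]
  refine iSup_le fun n => ?_
  have := setLIntegral_inner_rpow_le hV hB hD f (measurableSet_Icc (a := -(n : ℝ)) (b := n))
    measure_Icc_lt_top.ne
  rw [← ENNReal.rpow_inv_le_iff (by norm_num)]
  norm_num at this ⊢
  exact this

/-- The supremum over a countable family of curves. -/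
lemma lintegral_iSup_inner_rpow_le [SecondCountableTopology H] {V : ℕ → ℝ → H}
    (hV : ∀ k, Continuous (V k)) {B : ℕ → ℝ} (hB : ∀ k t, ‖V k t‖ ≤ B k) {D : ℝ≥0∞}
    (hD : ∀ k l t s, t ≠ s → ‖inner ℂ (V k t) (V l s)‖ₑ ≤ D * rieszKernel (t - s)) (f : H) :
    ∫⁻ t, (⨆ k, ‖inner ℂ (V k t) f‖ₑ) ^ (12 / 5 : ℝ) ≤
      ((28 * D) ^ (1 / 2 : ℝ) * ‖f‖ₑ) ^ (12 / 5 : ℝ) := by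
  classical
  let _ : MeasurableSpace H := borel H
  have : BorelSpace H := ⟨rfl⟩
  set a : ℕ → ℝ → ℝ≥0∞ := fun k t => ‖inner ℂ (V k t) f‖ₑ with ha
  have ma : ∀ k, Measurable (a k) := fun k => ((hV k).inner continuous_const).measurable.enorm
  have hex : ∀ (K : ℕ) (t : ℝ), ∃ k, k ≤ K ∧ ∀ j ≤ K, a j t ≤ a k t := by
    intro K t
    obtain ⟨k, hk, hmax⟩ := Finset.exists_max_image (Finset.range (K + 1)) (fun j => a j t)
      ⟨0, by simp⟩
    exact ⟨k, by simpa [Nat.lt_succ_iff] using hk, fun j hj => hmax j (by simpa [Nat.lt_succ_iff])⟩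
  -- Linearization of the supremum: `κ K t` is the least maximizing index among the first `K + 1`,
  -- which makes the choice measurable in `t`. The selected curve switches between the `V k`, hence
  -- `hD` is required for all pairs `k`, `l` with the same `D`.
  set κ : ℕ → ℝ → ℕ := fun K t => Nat.find (hex K t) with hκ
  have hκ1 : ∀ K t, κ K t ≤ K := fun K t => (Nat.find_spec (hex K t)).1
  have hκ2 : ∀ K t, ∀ j ≤ K, a j t ≤ a (κ K t) t := fun K t => (Nat.find_spec (hex K t)).2
  have mset : ∀ K k, MeasurableSet {t | k ≤ K ∧ ∀ j ≤ K, a j t ≤ a k t} := by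
    intro K k
    simp only [ofPred_and, ofPred_forall]
    exact (MeasurableSet.const _).inter
      (MeasurableSet.iInter fun j => MeasurableSet.iInter fun _ => measurableSet_le (ma j) (ma k))
  have mV : ∀ K, Measurable fun t => V (κ K t) t := fun K =>
    Measurable.find (fun k => (hV k).measurable) (mset K) (hex K)
  have hK : ∀ K, ∫⁻ t, a (κ K t) t ^ (12 / 5 : ℝ) ≤
      ((28 * D) ^ (1 / 2 : ℝ) * ‖f‖ₑ) ^ (12 / 5 : ℝ) := fun K =>
    lintegral_inner_rpow_le (mV K).stronglyMeasurable
      -- The bounds `B k` need not be uniform in `k`: only finitely many are used, and they do not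
      -- enter the conclusion.
      (B := (Finset.range (K + 1)).sup' ⟨0, by simp⟩ B)
      (fun t => (hB _ t).trans (Finset.le_sup' B (by simpa [Nat.lt_succ_iff] using hκ1 K t)))
      (fun t s => hD _ _ t s) f
  have hsup : ∀ t, (⨆ k, a k t) ^ (12 / 5 : ℝ) = ⨆ K, a (κ K t) t ^ (12 / 5 : ℝ) := by
    intro t
    have h1 : ⨆ k, a k t = ⨆ K, a (κ K t) t :=
      le_antisymm (iSup_mono fun k => hκ2 k t k le_rfl)
        (iSup_le fun K => le_iSup (fun k => a k t) (κ K t))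
    rw [h1]
    exact (ENNReal.orderIsoRpow (12 / 5) (by norm_num)).map_iSup _
  refine (lintegral_congr hsup).trans_le ?_
  rw [lintegral_iSup]
  · exact iSup_le hK
  · intro K
    have : Measurable fun t => a (κ K t) t := ((mV K).inner measurable_const).enorm
    exact this.pow_const _
  · intro K L hKL t
    exact ENNReal.rpow_le_rpow (hκ2 L t _ ((hκ1 K t).trans hKL)) (by norm_num)

end TTStar

/-! ### Dyadic bumps and the kernel of `P_N² U(t)` -/

/-- The profile `χ(s) - χ(2s)` of the dyadic bumps. -/
def bumpProfile (χ : ℝ → ℝ) (s : ℝ) : ℝ := χ s - χ (2 * s)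

lemma dyadicBump_eq_bumpProfile (χ : ℝ → ℝ) {N : ℝ} (hN : N ≠ 1) (ξ : ℝ) :
    dyadicBump χ N ξ = bumpProfile χ (ξ / N) := by
  rw [dyadicBump, if_neg hN, bumpProfile]

section Cutoff

variable {χ : ℝ → ℝ} (hχ : IsCutoff χ)

include hχ

lemma IsCutoff.contDiff_bumpProfile : ContDiff ℝ ∞ (bumpProfile χ) :=
  hχ.smooth.sub (hχ.smooth.comp (contDiff_const.mul contDiff_id))

lemma IsCutoff.bumpProfile_eq_zero {s : ℝ} (h : |s| ≤ 1 / 2 ∨ 2 ≤ |s|) : bumpProfile χ s = 0 := by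
  unfold bumpProfile
  rcases h with h | h
  · have h' := abs_le.1 h
    rw [hχ.eq_one s ⟨by linarith, by linarith⟩, hχ.eq_one (2 * s) ⟨by linarith, by linarith⟩,
      sub_self]
  · rw [hχ.eq_zero s (by linarith), hχ.eq_zero (2 * s) (by rw [abs_mul, abs_two]; linarith),
      sub_self]

lemma IsCutoff.abs_dyadicBump_le_one (N ξ : ℝ) : |dyadicBump χ N ξ| ≤ 1 := by
  rw [dyadicBump, abs_le]
  split_ifs
  · constructor <;> linarith [hχ.nonneg ξ, hχ.le_one ξ]
  · constructor <;> linarith [hχ.nonneg (ξ / N), hχ.le_one (ξ / N),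
      hχ.nonneg (2 * (ξ / N)), hχ.le_one (2 * (ξ / N))]

lemma IsCutoff.continuous_dyadicBump (N : ℝ) : Continuous (dyadicBump χ N) := by
  have h := hχ.smooth.continuous
  unfold dyadicBump
  split_ifs <;> fun_prop

end Cutoff

/-- The amplitude `(χ(σ η) - χ(2 σ η))² η^(-1/2)`. -/
def kernelAmplitude (χ : ℝ → ℝ) (σ η : ℝ) : ℝ :=
  bumpProfile χ (σ * η) ^ 2 * η ^ (-(1 / 2) : ℝ)

lemma IsCutoff.norm_integral_kernelAmplitude_le {χ : ℝ → ℝ} (hχ : IsCutoff χ) {σ : ℝ}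
    (hσ : |σ| = 1) {α τ : ℝ} (hα : α ∈ Icc (1 : ℝ) 2) (hτ : τ ≠ 0) (x β : ℝ) :
    ‖∫ η in (1 / 2)..2, (kernelAmplitude χ σ η : ℂ) * oscExp (kernelPhase α τ x β) η‖ ≤
      (66 * ∫ η in (1 / 2)..2, |deriv (kernelAmplitude χ σ) η|) * |τ| ^ (-(1 / 3) : ℝ) := by
  have hcd : ContDiffOn ℝ 1 (kernelAmplitude χ σ) (Ioi 0) := by
    have h1 : ContDiff ℝ 1 (fun η => bumpProfile χ (σ * η) ^ 2) :=
      ((hχ.contDiff_bumpProfile.of_le (by simp)).comp (contDiff_const.mul contDiff_id)).pow 2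
    exact h1.contDiffOn.mul fun η hη =>
      (Real.contDiffAt_rpow_const_of_ne (ne_of_gt hη)).contDiffWithinAt
  have hsub : Icc (1 / 2 : ℝ) 2 ⊆ Ioi 0 := fun η hη => by
    have := hη.1; simp only [mem_Ioi]; linarith
  refine norm_integral_mul_oscExp_kernelPhase_le hα hτ x β (fun η hη => ?_) ?_ ?_
  · exact ((hcd.contDiffAt (Ioi_mem_nhds (hsub hη))).differentiableAt (by simp)).hasDerivAt
  · exact (hcd.continuousOn_deriv_of_isOpen isOpen_Ioi le_rfl).mono hsub
  · rw [kernelAmplitude, hχ.bumpProfile_eq_zero (Or.inr (by rw [abs_mul, hσ]; norm_num))]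
    simp

/-- A positive factor does not change the argument, so it can be pulled out of the principal square
root. -/
lemma mul_inv_ofReal_cpow_half (z : ℂ) {r : ℝ} (hr : 0 < r) :
    (z * ((r⁻¹ : ℝ) : ℂ)) ^ (1 / 2 : ℂ) = z ^ (1 / 2 : ℂ) * ((r ^ (-(1 / 2) : ℝ) : ℝ) : ℂ) := by
  rcases eq_or_ne z 0 with rfl | hz
  · rw [zero_mul, Complex.zero_cpow (by norm_num), zero_mul]
  have hr' : 0 < r⁻¹ := inv_pos.2 hr
  have hr0 : ((r⁻¹ : ℝ) : ℂ) ≠ 0 := by exact_mod_cast hr'.ne'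
  have h1 : r ^ (-(1 / 2) : ℝ) = Real.exp (Real.log r⁻¹ * (1 / 2)) := by
    rw [Real.rpow_def_of_pos hr, Real.log_inv]; ring_nf
  rw [mul_comm z, Complex.cpow_def_of_ne_zero (mul_ne_zero hr0 hz), Complex.log_ofReal_mul hr' hz,
    add_mul, Complex.exp_add, Complex.cpow_def_of_ne_zero hz, h1, Complex.ofReal_exp, mul_comm]
  push_cast
  rfl

/-- The integrand, in the frequency `ξ`, of the kernel of `P_N² U(t)` at the point `(x, y)`, after
integrating out the frequency `μ` against the regularizing factor `exp (-δ μ²)`. -/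
def kernelIntegrand (χ : ℝ → ℝ) (α N t δ x y ξ : ℝ) : ℂ :=
  ((dyadicBump χ N ξ ^ 2 : ℝ) : ℂ) *
    (Complex.exp (Complex.I * ((t * (ξ * |ξ| ^ α) + x * ξ : ℝ) : ℂ)) *
      (((Real.pi : ℂ) / (δ - Complex.I * (t * ξ : ℝ))) ^ (1 / 2 : ℂ) *
        Complex.exp (-(y : ℂ) ^ 2 / (4 * (δ - Complex.I * (t * ξ : ℝ))))))

/-- The substitution `ξ = σ N η` on either half-line, with `σ = ±1`. The factor `η^(-1/2)` from the
Gaussian joins the amplitude and its imaginary exponent becomes the term `-β/η` of the phase. -/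
lemma kernelIntegrand_scale {χ : ℝ → ℝ} {α N t x y σ η : ℝ} (hN : 0 < N) (hN1 : N ≠ 1)
    (ht : t ≠ 0) (hσ : |σ| = 1) (hη : 0 < η) :
    kernelIntegrand χ α N t 0 x y (σ * N * η) =
      ((Real.pi : ℂ) / (-(Complex.I * (t * (σ * N) : ℝ)))) ^ (1 / 2 : ℂ) *
      ((kernelAmplitude χ σ η : ℂ) *
        oscExp (kernelPhase α (t * (σ * N) * N ^ α) (x * (σ * N)) (y ^ 2 / (4 * (t * (σ * N))))) η)
      := by
  have hσ0 : σ ≠ 0 := by rintro rfl; simp at hσ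
  have e1 : dyadicBump χ N (σ * N * η) = bumpProfile χ (σ * η) := by
    rw [dyadicBump_eq_bumpProfile χ hN1]; congr 1; field_simp
  have e2 : |σ * N * η| ^ α = N ^ α * η ^ α := by
    rw [abs_mul, abs_mul, hσ, one_mul, abs_of_pos hN, abs_of_pos hη, Real.mul_rpow hN.le hη.le]
  have e3 : ((Real.pi : ℂ) / ((0 : ℝ) - Complex.I * (t * (σ * N * η) : ℝ))) ^ (1 / 2 : ℂ) =
      ((Real.pi : ℂ) / (-(Complex.I * (t * (σ * N) : ℝ)))) ^ (1 / 2 : ℂ) *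
        ((η ^ (-(1 / 2) : ℝ) : ℝ) : ℂ) := by
    have : (Real.pi : ℂ) / ((0 : ℝ) - Complex.I * (t * (σ * N * η) : ℝ)) =
        ((Real.pi : ℂ) / (-(Complex.I * (t * (σ * N) : ℝ)))) * ((η⁻¹ : ℝ) : ℂ) := by
      have h1 : (t : ℂ) ≠ 0 := by exact_mod_cast ht
      have h2 : (σ : ℂ) ≠ 0 := by exact_mod_cast hσ0
      have h3 : (N : ℂ) ≠ 0 := by exact_mod_cast hN.ne'
      have h4 : (η : ℂ) ≠ 0 := by exact_mod_cast hη.ne'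
      push_cast
      rw [zero_sub]
      field_simp
    rw [this, mul_inv_ofReal_cpow_half _ hη]
  have e4 : Complex.exp (Complex.I *
        ((t * (σ * N * η * |σ * N * η| ^ α) + x * (σ * N * η) : ℝ) : ℂ)) *
      Complex.exp (-(y : ℂ) ^ 2 / (4 * ((0 : ℝ) - Complex.I * (t * (σ * N * η) : ℝ)))) =
      oscExp (kernelPhase α (t * (σ * N) * N ^ α) (x * (σ * N)) (y ^ 2 / (4 * (t * (σ * N))))) η := by
    rw [oscExp, ← Complex.exp_add, kernelPhase, e2, Real.rpow_add_one hη.ne']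
    congr 1
    have h1 : (t : ℂ) ≠ 0 := by exact_mod_cast ht
    have h2 : (σ : ℂ) ≠ 0 := by exact_mod_cast hσ0
    have h3 : (N : ℂ) ≠ 0 := by exact_mod_cast hN.ne'
    have h4 : (η : ℂ) ≠ 0 := by exact_mod_cast hη.ne'
    push_cast
    have h5 : -(y : ℂ) ^ 2 / (4 * (0 - Complex.I * (t * (σ * N * η)))) =
        -(Complex.I * (y ^ 2 / (4 * (t * (σ * N))) / η)) := by
      rw [zero_sub]
      field_simp
      simp
    rw [h5]
    ring
  rw [kernelIntegrand, e1, e3, kernelAmplitude, ← e4]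
  push_cast
  ring

lemma norm_cpow_half (z : ℂ) : ‖z ^ (1 / 2 : ℂ)‖ = ‖z‖ ^ (1 / 2 : ℝ) := by
  rw [← Complex.norm_cpow_real]; norm_num

lemma abs_le_norm_sub_I_mul (δ v : ℝ) : |v| ≤ ‖(δ : ℂ) - Complex.I * (v : ℂ)‖ := by
  refine le_trans (le_of_eq ?_) (Complex.abs_im_le_norm _)
  simp

/-- For `b = δ - i t ξ` one has `|b| ≥ |t ξ|`, and `Re (1/b) ≥ 0` bounds the Gaussian factor by 1.
The estimate is uniform in `δ ≥ 0`, so it can serve as a majorant as `δ → 0`. -/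
lemma norm_kernelIntegrand_le (χ : ℝ → ℝ) (α N x y : ℝ) {t δ ξ : ℝ} (hδ : 0 ≤ δ) (ht : t ≠ 0)
    (hξ : ξ ≠ 0) :
    ‖kernelIntegrand χ α N t δ x y ξ‖ ≤
      dyadicBump χ N ξ ^ 2 * (Real.pi / (|t| * |ξ|)) ^ (1 / 2 : ℝ) := by
  have hv : 0 < |t * ξ| := abs_pos.2 (mul_ne_zero ht hξ)
  have h1 := abs_le_norm_sub_I_mul δ (t * ξ)
  set b : ℂ := (δ : ℂ) - Complex.I * ((t * ξ : ℝ) : ℂ) with hb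
  have hbre : b.re = δ := by simp [hb]
  rw [kernelIntegrand, norm_mul, norm_mul, norm_mul, Complex.norm_real,
    Complex.norm_exp_I_mul_ofReal, one_mul, norm_cpow_half, ← hb, norm_div, Complex.norm_real,
    Real.norm_of_nonneg Real.pi_pos.le, Real.norm_of_nonneg (sq_nonneg _), ← abs_mul]
  have h2 : ‖Complex.exp (-(y : ℂ) ^ 2 / (4 * b))‖ ≤ 1 := by
    rw [Complex.norm_exp, Real.exp_le_one_iff]
    have : -(y : ℂ) ^ 2 / (4 * b) = ((-(y ^ 2 / 4) : ℝ) : ℂ) * b⁻¹ := by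
      push_cast
      rw [div_eq_mul_inv, mul_inv]; ring
    rw [this, Complex.re_ofReal_mul, Complex.inv_re, hbre]
    exact mul_nonpos_of_nonpos_of_nonneg (by nlinarith [sq_nonneg y])
      (div_nonneg hδ (Complex.normSq_nonneg _))
  refine mul_le_mul_of_nonneg_left ?_ (sq_nonneg _)
  calc _ ≤ (Real.pi / ‖b‖) ^ (1 / 2 : ℝ) * 1 := by gcongr
    _ ≤ _ := by
      rw [mul_one]
      have := Real.pi_pos
      gcongr

lemma IsCutoff.norm_kernelIntegrand_le {χ : ℝ → ℝ} (hχ : IsCutoff χ) (α x y : ℝ) {N t δ : ℝ}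
    (hN : 0 < N) (hN1 : N ≠ 1) (hδ : 0 ≤ δ) (ht : t ≠ 0) (ξ : ℝ) :
    ‖kernelIntegrand χ α N t δ x y ξ‖ ≤
      dyadicBump χ N ξ ^ 2 * (Real.pi / (|t| * (N / 2))) ^ (1 / 2 : ℝ) := by
  by_cases h : |ξ| ≤ N / 2
  · have h0 : dyadicBump χ N ξ = 0 := by
      rw [dyadicBump_eq_bumpProfile χ hN1]
      refine hχ.bumpProfile_eq_zero (Or.inl ?_)
      rw [abs_div, abs_of_pos hN, div_le_iff₀ hN]; linarith
    rw [kernelIntegrand, h0]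
    simp
  · rw [not_le] at h
    have hξ : ξ ≠ 0 := by rintro rfl; rw [abs_zero] at h; linarith
    refine (_root_.norm_kernelIntegrand_le χ α N x y hδ ht hξ).trans ?_
    have := Real.pi_pos
    have := abs_pos.2 ht
    refine mul_le_mul_of_nonneg_left ?_ (sq_nonneg _)
    gcongr

lemma IsCutoff.integrable_dyadicBump_sq {χ : ℝ → ℝ} (hχ : IsCutoff χ) {N : ℝ} (hN : 0 < N)
    (hN1 : N ≠ 1) : Integrable (fun ξ => dyadicBump χ N ξ ^ 2) := by
  refine Continuous.integrable_of_hasCompactSupport ((hχ.continuous_dyadicBump N).pow 2) ?_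
  refine HasCompactSupport.intro (isCompact_Icc (a := -(2 * N)) (b := 2 * N)) fun ξ hξ => ?_
  have h : 2 * N ≤ |ξ| := by
    by_contra h
    exact hξ (abs_le.1 (not_le.1 h).le)
  rw [dyadicBump_eq_bumpProfile χ hN1, hχ.bumpProfile_eq_zero (Or.inr ?_)]
  · norm_num
  · rw [abs_div, abs_of_pos hN, le_div_iff₀ hN]; exact h

lemma IsCutoff.measurable_kernelIntegrand {χ : ℝ → ℝ} (hχ : IsCutoff χ) (α N t δ x y : ℝ) :
    Measurable (kernelIntegrand χ α N t δ x y) := by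
  have := (hχ.continuous_dyadicBump N).measurable
  unfold kernelIntegrand
  fun_prop

lemma IsCutoff.integrable_kernelIntegrand {χ : ℝ → ℝ} (hχ : IsCutoff χ) (α x y : ℝ) {N t δ : ℝ}
    (hN : 0 < N) (hN1 : N ≠ 1) (hδ : 0 ≤ δ) (ht : t ≠ 0) :
    Integrable (kernelIntegrand χ α N t δ x y) :=
  ((hχ.integrable_dyadicBump_sq hN hN1).mul_const _).mono'
    (hχ.measurable_kernelIntegrand α N t δ x y).aestronglyMeasurable
    (Filter.Eventually.of_forall (hχ.norm_kernelIntegrand_le α x y hN hN1 hδ ht))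

open Filter Topology in
lemma IsCutoff.tendsto_integral_kernelIntegrand {χ : ℝ → ℝ} (hχ : IsCutoff χ) (α x y : ℝ)
    {N t : ℝ} (hN : 0 < N) (hN1 : N ≠ 1) (ht : t ≠ 0) :
    Tendsto (fun δ => ∫ ξ, kernelIntegrand χ α N t δ x y ξ) (𝓝[>] 0)
      (𝓝 (∫ ξ, kernelIntegrand χ α N t 0 x y ξ)) := by
  refine tendsto_integral_filter_of_dominated_convergence _
    (Eventually.of_forall fun δ => (hχ.measurable_kernelIntegrand α N t δ x y).aestronglyMeasurable)
    ?_ ((hχ.integrable_dyadicBump_sq hN hN1).mul_const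
      ((Real.pi / (|t| * (N / 2))) ^ (1 / 2 : ℝ))) ?_
  · filter_upwards [self_mem_nhdsWithin] with δ hδ
    exact Eventually.of_forall
      (hχ.norm_kernelIntegrand_le α x y hN hN1 (le_of_lt (mem_Ioi.1 hδ)) ht)
  · filter_upwards [compl_mem_ae_iff.2 (measure_singleton (μ := volume) (0 : ℝ))] with ξ hξ
    have hv : t * ξ ≠ 0 := mul_ne_zero ht hξ
    have hb : ((0 : ℝ) : ℂ) - Complex.I * ((t * ξ : ℝ) : ℂ) ≠ 0 := by
      intro h
      have := congrArg Complex.im h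
      simp at this
      exact hv (by simpa using this)
    have hcont : ContinuousAt (fun δ : ℝ => kernelIntegrand χ α N t δ x y ξ) 0 := by
      unfold kernelIntegrand
      have c1 : ContinuousAt (fun δ : ℝ => (δ : ℂ) - Complex.I * ((t * ξ : ℝ) : ℂ)) 0 := by fun_prop
      refine continuousAt_const.mul (continuousAt_const.mul (ContinuousAt.mul ?_ ?_))
      · refine ContinuousAt.cpow (continuousAt_const.div c1 hb) continuousAt_const ?_
        -- At `δ = 0` the base of the square root is purely imaginary and nonzero, hence off the
        -- branch cut.
        refine Complex.mem_slitPlane_iff.2 (Or.inr ?_)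
        rw [Complex.div_im]
        simp only [Complex.ofReal_im, Complex.ofReal_re]
        have : ((0 : ℝ) - Complex.I * ((t * ξ : ℝ) : ℂ) : ℂ).im ≠ 0 := by simpa using hv
        have h3 : Complex.normSq (((0 : ℝ) : ℂ) - Complex.I * ((t * ξ : ℝ) : ℂ)) ≠ 0 :=
          fun h => hb (Complex.normSq_eq_zero.1 h)
        rw [zero_mul, zero_div, zero_sub, neg_ne_zero]
        exact div_ne_zero (mul_ne_zero Real.pi_ne_zero this) h3
      · exact (continuousAt_const.div (continuousAt_const.mul c1)
          (mul_ne_zero (by norm_num) hb)).cexp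
    exact hcont.tendsto.mono_left nhdsWithin_le_nhds

lemma IsCutoff.norm_setIntegral_kernelIntegrand_le {χ : ℝ → ℝ} (hχ : IsCutoff χ) {α : ℝ}
    (hα : α ∈ Icc (1 : ℝ) 2) (x y : ℝ) {N t σ : ℝ} (hN : 0 < N) (hN1 : N ≠ 1) (ht : t ≠ 0)
    (hσ : |σ| = 1) :
    ‖∫ ξ in Ioi (0 : ℝ), kernelIntegrand χ α N t 0 x y (σ * ξ)‖ ≤
      N * ((Real.pi / (|t| * N)) ^ (1 / 2 : ℝ) *
        ((66 * ∫ η in (1 / 2)..2, |deriv (kernelAmplitude χ σ) η|) *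
          (|t| * (N * N ^ α)) ^ (-(1 / 3) : ℝ))) := by
  have hσ0 : σ ≠ 0 := by rintro rfl; simp at hσ
  have e1 := integral_comp_mul_left_Ioi (fun ξ => kernelIntegrand χ α N t 0 x y (σ * ξ)) 0 hN
  rw [mul_zero] at e1
  have e2 : ∫ ξ in Ioi (0 : ℝ), kernelIntegrand χ α N t 0 x y (σ * ξ) =
      (N : ℂ) * ∫ η in Ioi (0 : ℝ), kernelIntegrand χ α N t 0 x y (σ * (N * η)) := by
    rw [e1, Complex.real_smul, ← mul_assoc]
    have : (N : ℂ) ≠ 0 := by exact_mod_cast hN.ne'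
    push_cast
    rw [mul_inv_cancel₀ this, one_mul]
  have e3 : ∫ η in Ioi (0 : ℝ), kernelIntegrand χ α N t 0 x y (σ * (N * η)) =
      ∫ η in Ioc (1 / 2 : ℝ) 2, kernelIntegrand χ α N t 0 x y (σ * (N * η)) := by
    refine setIntegral_eq_of_subset_of_forall_sdiff_eq_zero measurableSet_Ioi
      (fun η hη => by have := hη.1; simp only [mem_Ioi]; linarith) fun η hη => ?_
    have h0 : 0 < η := hη.1
    have : dyadicBump χ N (σ * (N * η)) = 0 := by
      rw [dyadicBump_eq_bumpProfile χ hN1]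
      refine hχ.bumpProfile_eq_zero ?_
      rw [abs_div, abs_mul, hσ, abs_mul, abs_of_pos hN, abs_of_pos h0, one_mul,
        mul_div_cancel_left₀ _ hN.ne']
      by_contra! hcon
      exact hη.2 ⟨hcon.1, hcon.2.le⟩
    rw [kernelIntegrand, this]
    simp
  have e4 : ∫ η in Ioc (1 / 2 : ℝ) 2, kernelIntegrand χ α N t 0 x y (σ * (N * η)) =
      ((Real.pi : ℂ) / (-(Complex.I * (t * (σ * N) : ℝ)))) ^ (1 / 2 : ℂ) *
      ∫ η in (1 / 2)..2, (kernelAmplitude χ σ η : ℂ) *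
        oscExp (kernelPhase α (t * (σ * N) * N ^ α) (x * (σ * N)) (y ^ 2 / (4 * (t * (σ * N))))) η
      := by
    rw [intervalIntegral.integral_of_le (by norm_num), ← integral_const_mul]
    refine setIntegral_congr_fun measurableSet_Ioc fun η hη => ?_
    have h0 : 0 < η := by have := hη.1; linarith
    simp only [← mul_assoc σ N η]
    exact kernelIntegrand_scale hN hN1 ht hσ h0
  have hNα : 0 < N ^ α := Real.rpow_pos_of_pos hN α
  have hτ : t * (σ * N) * N ^ α ≠ 0 :=
    mul_ne_zero (mul_ne_zero ht (mul_ne_zero hσ0 hN.ne')) hNα.ne'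
  have hτ' : |t * (σ * N) * N ^ α| = |t| * (N * N ^ α) := by
    rw [abs_mul, abs_mul, abs_mul, hσ, abs_of_pos hN, abs_of_pos hNα]; ring
  rw [e2, e3, e4, norm_mul, norm_mul, Complex.norm_real, Real.norm_of_nonneg hN.le, norm_cpow_half]
  have h1 : ‖(Real.pi : ℂ) / (-(Complex.I * (t * (σ * N) : ℝ)))‖ = Real.pi / (|t| * N) := by
    rw [norm_div, norm_neg, norm_mul, Complex.norm_I, Complex.norm_real, Complex.norm_real,
      Real.norm_of_nonneg Real.pi_pos.le, Real.norm_eq_abs, abs_mul, abs_mul, hσ, abs_of_pos hN,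
      one_mul, one_mul]
  rw [h1, ← hτ']
  gcongr
  exact hχ.norm_integral_kernelAmplitude_le hσ hα hτ _ _

/-- The decay of the kernel of `P_N² U(t)`. -/
lemma IsCutoff.exists_norm_integral_kernelIntegrand_le {χ : ℝ → ℝ} (hχ : IsCutoff χ) :
    ∃ C : ℝ, 0 < C ∧ ∀ α ∈ Icc (1 : ℝ) 2, ∀ N t x y : ℝ, 0 < N → N ≠ 1 → t ≠ 0 →
      ‖∫ ξ, kernelIntegrand χ α N t 0 x y ξ‖ ≤
        C * N ^ (-(1 / 3) * (α - 1 / 2)) * |t| ^ (-(5 / 6) : ℝ) := by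
  set c : ℝ → ℝ := fun σ => 66 * ∫ η in (1 / 2)..2, |deriv (kernelAmplitude χ σ) η| with hc
  have hc0 : ∀ σ, 0 ≤ c σ := fun σ => mul_nonneg (by norm_num)
    (intervalIntegral.integral_nonneg (by norm_num) fun _ _ => abs_nonneg _)
  -- One constant for each half-line; the summand 1 only ensures positivity.
  refine ⟨Real.pi ^ (1 / 2 : ℝ) * (c 1 + c (-1) + 1),
    mul_pos (Real.rpow_pos_of_pos Real.pi_pos _) (by linarith [hc0 1, hc0 (-1)]), ?_⟩
  intro α hα N t x y hN hN1 ht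
  have hi := hχ.integrable_kernelIntegrand α x y hN hN1 le_rfl ht
  have hpos := hχ.norm_setIntegral_kernelIntegrand_le hα x y hN hN1 ht (σ := 1) (by simp)
  have hneg := hχ.norm_setIntegral_kernelIntegrand_le hα x y hN hN1 ht (σ := -1) (by simp)
  simp only [one_mul, neg_one_mul] at hpos hneg
  rw [integral_comp_neg_Ioi, neg_zero] at hneg
  rw [← intervalIntegral.integral_Iic_add_Ioi hi.integrableOn hi.integrableOn (b := 0)]
  have ht' : 0 < |t| := abs_pos.2 ht
  have hpow : N * ((Real.pi / (|t| * N)) ^ (1 / 2 : ℝ) * (|t| * (N * N ^ α)) ^ (-(1 / 3) : ℝ)) =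
      Real.pi ^ (1 / 2 : ℝ) * (N ^ (-(1 / 3) * (α - 1 / 2)) * |t| ^ (-(5 / 6) : ℝ)) := by
    rw [Real.div_rpow Real.pi_pos.le (by positivity), Real.mul_rpow ht'.le hN.le,
      Real.mul_rpow ht'.le (by positivity), Real.mul_rpow hN.le (by positivity),
      ← Real.rpow_mul hN.le, div_eq_mul_inv, mul_inv, ← Real.rpow_neg ht'.le, ← Real.rpow_neg hN.le]
    have h1 : |t| ^ (-(5 / 6) : ℝ) = |t| ^ (-(1 / 2) : ℝ) * |t| ^ (-(1 / 3) : ℝ) := by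
      rw [← Real.rpow_add ht']; norm_num
    have h2 : N ^ (-(1 / 3) * (α - 1 / 2)) =
        N * N ^ (-(1 / 2) : ℝ) * N ^ (-(1 / 3) : ℝ) * N ^ (α * -(1 / 3)) := by
      nth_rewrite 2 [← Real.rpow_one N]
      rw [← Real.rpow_add hN, ← Real.rpow_add hN, ← Real.rpow_add hN]
      ring_nf
    rw [h1, h2]
    ring
  set E := N ^ (-(1 / 3) * (α - 1 / 2)) * |t| ^ (-(5 / 6) : ℝ) with hE
  have hE0 : 0 ≤ E := by positivity
  have hre : ∀ σ, N * ((Real.pi / (|t| * N)) ^ (1 / 2 : ℝ) *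
      (c σ * (|t| * (N * N ^ α)) ^ (-(1 / 3) : ℝ))) = Real.pi ^ (1 / 2 : ℝ) * c σ * E := by
    intro σ
    calc _ = c σ * (N * ((Real.pi / (|t| * N)) ^ (1 / 2 : ℝ) *
          (|t| * (N * N ^ α)) ^ (-(1 / 3) : ℝ))) := by ring
      _ = _ := by rw [hpow]; ring
  have hp := hre 1
  have hn := hre (-1)
  calc _ ≤ _ := norm_add_le _ _
    _ ≤ Real.pi ^ (1 / 2 : ℝ) * c (-1) * E + Real.pi ^ (1 / 2 : ℝ) * c 1 * E :=
      add_le_add (hneg.trans_eq hn) (hpos.trans_eq hp)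
    _ ≤ _ := by
      rw [mul_assoc _ (N ^ _), ← hE]
      have : 0 ≤ Real.pi ^ (1 / 2 : ℝ) * E := by positivity
      nlinarith

/-! ### Fourier analysis on the plane and the dispersive estimate -/

lemma integral_fourier_mul {f W : Plane → ℂ} (hf : Integrable f) (hW : Integrable W) :
    ∫ ζ, 𝓕 f ζ * W ζ = ∫ z, f z * 𝓕 W z := by
  have := VectorFourier.integral_fourierIntegral_smul_eq_flip (L := innerₗ Plane)
    Real.continuous_fourierChar continuous_inner hf hW
  rw [flip_innerₗ] at this
  simp only [smul_eq_mul] at this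
  exact this

lemma continuous_fourier_of_integrable {W : Plane → ℂ} (hW : Integrable W) : Continuous (𝓕 W) :=
  VectorFourier.fourierIntegral_continuous (L := innerₗ Plane) Real.continuous_fourierChar
    continuous_inner hW

lemma norm_fourier_le_integral_norm (W : Plane → ℂ) (ζ : Plane) : ‖𝓕 W ζ‖ ≤ ∫ z, ‖W z‖ :=
  VectorFourier.norm_fourierIntegral_le_integral_norm _ _ _ _ _

lemma conj_fourier_eq (g : Plane → ℂ) (ζ : Plane) :
    (starRingEnd ℂ) (𝓕 g ζ) = 𝓕 (fun z => (starRingEnd ℂ) (g (-z))) ζ := by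
  rw [Real.fourier_eq', Real.fourier_eq', ← integral_conj, ← integral_neg_eq_self]
  refine integral_congr_ae (Filter.Eventually.of_forall fun z => ?_)
  simp only [smul_eq_mul, map_mul, ← Complex.exp_conj, Complex.conj_I, Complex.conj_ofReal,
    inner_neg_left]
  push_cast
  ring_nf

/-- A bound for a bilinear form on the frequency side by its kernel. -/
lemma enorm_integral_conj_fourier_mul_fourier_mul_le {g h W : Plane → ℂ} (hg : Integrable g)
    (hh : Integrable h) (hgc : Continuous g) (hhc : Continuous h) (hW : Integrable W) :
    ‖∫ ζ, (starRingEnd ℂ) (𝓕 g ζ) * 𝓕 h ζ * W ζ‖ₑ ≤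
      ∫⁻ p : Plane × Plane, ‖h p.1‖ₑ * ‖g p.2‖ₑ * ‖𝓕⁻ W (p.2 - p.1)‖ₑ := by
  set k : Plane → ℂ := fun z => (starRingEnd ℂ) (g (-z)) with hk
  have hki : Integrable k := by
    have h1 : Integrable fun z => (starRingEnd ℂ) (g z) :=
      hg.norm.mono' (by fun_prop) (Filter.Eventually.of_forall fun z => by simp)
    exact h1.comp_neg
  have hkW : Integrable fun ζ => 𝓕 k ζ * W ζ :=
    hW.bdd_mul (continuous_fourier_of_integrable hki).aestronglyMeasurable
      (Filter.Eventually.of_forall (norm_fourier_le_integral_norm k))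
  have e1 : ∫ ζ, (starRingEnd ℂ) (𝓕 g ζ) * 𝓕 h ζ * W ζ =
      ∫ x, h x * 𝓕 (fun ζ => 𝓕 k ζ * W ζ) x := by
    rw [← integral_fourier_mul hh hkW]
    refine integral_congr_ae (Filter.Eventually.of_forall fun ζ => ?_)
    simp only [conj_fourier_eq g ζ]
    ring
  have e2 : ∀ x, ‖𝓕 (fun ζ => 𝓕 k ζ * W ζ) x‖ₑ ≤ ∫⁻ z, ‖g z‖ₑ * ‖𝓕⁻ W (z - x)‖ₑ := by
    intro x
    -- The character coming from evaluation at `x` is absorbed into `W`, where it translates the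
    -- kernel.
    set U : Plane → ℂ := fun ζ => Complex.exp (((-2 * Real.pi * inner ℝ ζ x : ℝ) : ℂ) * Complex.I) * W ζ
      with hU
    have hUi : Integrable U := hW.bdd_mul (c := 1) (by fun_prop)
      (Filter.Eventually.of_forall fun ζ => by rw [Complex.norm_exp_ofReal_mul_I])
    have h1 : 𝓕 (fun ζ => 𝓕 k ζ * W ζ) x = ∫ z, k z * 𝓕 U z := by
      rw [← integral_fourier_mul hki hUi, Real.fourier_eq']
      refine integral_congr_ae (Filter.Eventually.of_forall fun ζ => ?_)
      simp only [smul_eq_mul, hU]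
      ring
    have h2 : ∀ z, 𝓕 U z = 𝓕⁻ W (-z - x) := by
      intro z
      rw [Real.fourier_eq', Real.fourierInv_eq']
      refine integral_congr_ae (Filter.Eventually.of_forall fun ζ => ?_)
      simp only [smul_eq_mul, hU]
      rw [← mul_assoc, ← Complex.exp_add, inner_sub_right, inner_neg_right]
      congr 2
      push_cast
      ring
    rw [h1]
    refine (enorm_integral_le_lintegral_enorm _).trans (le_of_eq ?_)
    rw [← lintegral_neg_eq_self]
    refine lintegral_congr fun z => ?_
    rw [enorm_mul, h2, hk]
    simp
  have hF : Continuous (𝓕⁻ W) := by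
    have : (𝓕⁻ W) = fun z => 𝓕 W (-z) := funext fun z => Real.fourierInv_eq_fourier_neg W z
    rw [this]
    exact (continuous_fourier_of_integrable hW).comp continuous_neg
  rw [e1, Measure.volume_eq_prod, lintegral_prod _ (by fun_prop)]
  refine (enorm_integral_le_lintegral_enorm _).trans (lintegral_mono fun x => ?_)
  simp only [mul_assoc]
  rw [enorm_mul, lintegral_const_mul _ (by fun_prop)]
  gcongr
  exact e2 x

/-- Coordinates on the plane. -/
def planeEquiv : Plane ≃ᵐ ℝ × ℝ :=
  (MeasurableEquiv.toLp 2 (Fin 2 → ℝ)).symm.trans MeasurableEquiv.finTwoArrow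

lemma planeEquiv_apply (ζ : Plane) : planeEquiv ζ = (ζ 0, ζ 1) := rfl

lemma measurePreserving_planeEquiv : MeasurePreserving planeEquiv :=
  (volume_preserving_finTwoArrow ℝ).comp
    (EuclideanSpace.volume_preserving_symm_measurableEquiv_toLp (Fin 2))

lemma integral_plane {F : ℝ → ℝ → ℂ} (hF : Integrable fun p : ℝ × ℝ => F p.1 p.2) :
    ∫ ζ : Plane, F (ζ 0) (ζ 1) = ∫ ξ, ∫ μ, F ξ μ := by
  have := measurePreserving_planeEquiv.integral_comp' (g := fun p : ℝ × ℝ => F p.1 p.2)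
  simp only [planeEquiv_apply] at this
  rw [this, Measure.volume_eq_prod, integral_prod _ hF]

lemma integrable_plane {F : ℝ → ℝ → ℂ} (hF : Integrable fun p : ℝ × ℝ => F p.1 p.2) :
    Integrable fun ζ : Plane => F (ζ 0) (ζ 1) :=
  (measurePreserving_planeEquiv.integrable_comp_emb planeEquiv.measurableEmbedding).2 hF

/-- The symbol of `P_N² U(t)` in coordinates, with the regularizing factor `exp (-δ μ²)`. -/
def regularizedSymbol (χ : ℝ → ℝ) (α N t δ ξ μ : ℝ) : ℂ :=
  ((dyadicBump χ N ξ ^ 2 : ℝ) : ℂ) *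
    (Complex.exp (Complex.I * ((t * (ξ * (|ξ| ^ α + μ ^ 2)) : ℝ) : ℂ)) *
      ((Real.exp (-δ * μ ^ 2) : ℝ) : ℂ))

lemma norm_regularizedSymbol (χ : ℝ → ℝ) (α N t δ ξ μ : ℝ) :
    ‖regularizedSymbol χ α N t δ ξ μ‖ = dyadicBump χ N ξ ^ 2 * Real.exp (-δ * μ ^ 2) := by
  rw [regularizedSymbol, norm_mul, norm_mul, Complex.norm_exp_I_mul_ofReal, Complex.norm_real,
    Complex.norm_real, Real.norm_of_nonneg (sq_nonneg _), Real.norm_of_nonneg (Real.exp_pos _).le,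
    one_mul]

lemma continuous_regularizedSymbol (χ : ℝ → ℝ) (α N t ξ μ : ℝ) :
    Continuous fun δ => regularizedSymbol χ α N t δ ξ μ := by
  unfold regularizedSymbol
  fun_prop

section Cutoff

variable {χ : ℝ → ℝ} (hχ : IsCutoff χ)

include hχ

lemma IsCutoff.measurable_regularizedSymbol (α N t δ : ℝ) :
    Measurable fun p : ℝ × ℝ => regularizedSymbol χ α N t δ p.1 p.2 := by
  have := (hχ.continuous_dyadicBump N).measurable
  unfold regularizedSymbol
  fun_prop

lemma IsCutoff.measurable_regularizedSymbol_angularFreq (α N t δ : ℝ) :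
    Measurable fun ζ : Plane =>
      regularizedSymbol χ α N t δ (angularFreq ζ 0) (angularFreq ζ 1) := by
  have := (hχ.continuous_dyadicBump N).measurable
  unfold regularizedSymbol angularFreq
  fun_prop

lemma IsCutoff.integrable_regularizedSymbol_mul_exp (α t x y : ℝ) {N δ : ℝ} (hN : 0 < N)
    (hN1 : N ≠ 1) (hδ : 0 < δ) :
    Integrable fun p : ℝ × ℝ => Complex.exp (((p.1 * x + p.2 * y : ℝ) : ℂ) * Complex.I) *
      regularizedSymbol χ α N t δ p.1 p.2 := by
  have h1 := (hχ.integrable_dyadicBump_sq hN hN1).mul_prod (integrable_exp_neg_mul_sq hδ)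
  refine h1.mono' ?_ (Filter.Eventually.of_forall fun p => ?_)
  · refine Measurable.aestronglyMeasurable (Measurable.mul (by fun_prop) ?_)
    exact hχ.measurable_regularizedSymbol α N t δ
  · rw [norm_mul, Complex.norm_exp_ofReal_mul_I, one_mul, norm_regularizedSymbol]

/-- Fubini and the complex Gaussian integral in `μ` with quadratic coefficient `-(δ - i t ξ)`.
Without `δ > 0` the symbol does not decay in `μ` and neither step is available. -/
lemma IsCutoff.integral_regularizedSymbol (α t x y : ℝ) {N δ : ℝ} (hN : 0 < N)
    (hN1 : N ≠ 1) (hδ : 0 < δ) :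
    ∫ ζ : Plane, Complex.exp (((ζ 0 * x + ζ 1 * y : ℝ) : ℂ) * Complex.I) *
      regularizedSymbol χ α N t δ (ζ 0) (ζ 1) = ∫ ξ, kernelIntegrand χ α N t δ x y ξ := by
  rw [integral_plane (F := fun ξ μ => Complex.exp (((ξ * x + μ * y : ℝ) : ℂ) * Complex.I) *
    regularizedSymbol χ α N t δ ξ μ) (hχ.integrable_regularizedSymbol_mul_exp α t x y hN hN1 hδ)]
  refine integral_congr_ae (Filter.Eventually.of_forall fun ξ => ?_)
  set b : ℂ := -(δ - Complex.I * (t * ξ : ℝ)) with hb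
  have hbre : b.re < 0 := by simpa [hb] using hδ
  have h1 : ∀ μ : ℝ, Complex.exp (((ξ * x + μ * y : ℝ) : ℂ) * Complex.I) *
      regularizedSymbol χ α N t δ ξ μ =
      (((dyadicBump χ N ξ ^ 2 : ℝ) : ℂ) *
        Complex.exp (Complex.I * ((t * (ξ * |ξ| ^ α) + x * ξ : ℝ) : ℂ))) *
      Complex.exp (b * μ ^ 2 + (Complex.I * y) * μ + 0) := by
    intro μ
    rw [regularizedSymbol, Complex.ofReal_exp, mul_left_comm, mul_assoc, ← Complex.exp_add,
      ← Complex.exp_add, ← Complex.exp_add]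
    congr 2
    rw [hb]
    push_cast
    ring
  simp only [h1]
  rw [integral_const_mul, integral_cexp_quadratic hbre, kernelIntegrand]
  have h2 : (Real.pi : ℂ) / -b = Real.pi / (δ - Complex.I * (t * ξ : ℝ)) := by rw [hb, neg_neg]
  have h3 : (0 : ℂ) - (Complex.I * y) ^ 2 / (4 * b) =
      -(y : ℂ) ^ 2 / (4 * (δ - Complex.I * (t * ξ : ℝ))) := by
    rw [hb, mul_pow, Complex.I_sq, mul_neg, div_neg, zero_sub, neg_neg]
    ring
  rw [h2, h3]
  ring

lemma IsCutoff.fourierInv_regularizedSymbol (α t : ℝ) {N δ : ℝ} (hN : 0 < N)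
    (hN1 : N ≠ 1) (hδ : 0 < δ) (z : Plane) :
    𝓕⁻ (fun ζ : Plane => regularizedSymbol χ α N t δ (angularFreq ζ 0) (angularFreq ζ 1)) z =
      (((2 * Real.pi) ^ 2)⁻¹ : ℝ) • ∫ ξ, kernelIntegrand χ α N t δ (z 0) (z 1) ξ := by
  rw [← hχ.integral_regularizedSymbol α t (z 0) (z 1) hN hN1 hδ, Real.fourierInv_eq']
  have := Measure.integral_comp_smul (volume : Measure Plane)
    (fun ζ : Plane => Complex.exp (((ζ 0 * z 0 + ζ 1 * z 1 : ℝ) : ℂ) * Complex.I) *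
      regularizedSymbol χ α N t δ (ζ 0) (ζ 1)) (2 * Real.pi)
  rw [finrank_euclideanSpace_fin, abs_of_nonneg (by positivity)] at this
  rw [← this]
  refine integral_congr_ae (Filter.Eventually.of_forall fun ζ => ?_)
  simp only [smul_eq_mul, angularFreq]
  congr 3
  rw [PiLp.inner_apply]
  simp
  ring

lemma IsCutoff.integrable_regularizedSymbol_angularFreq (α t : ℝ) {N δ : ℝ} (hN : 0 < N)
    (hN1 : N ≠ 1) (hδ : 0 < δ) :
    Integrable fun ζ : Plane =>
      regularizedSymbol χ α N t δ (angularFreq ζ 0) (angularFreq ζ 1) := by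
  have h1 := hχ.integrable_regularizedSymbol_mul_exp α t 0 0 hN hN1 hδ
  simp only [mul_zero, add_zero, Complex.ofReal_zero, zero_mul, Complex.exp_zero, one_mul] at h1
  exact (integrable_plane h1).comp_smul (by positivity : (2 * Real.pi) ≠ 0)

open Filter Topology in
/-- The dispersive estimate for `P_N² U(t)`. -/
lemma IsCutoff.exists_dispersive_bound :
    ∃ C : ℝ, 0 < C ∧ ∀ α ∈ Icc (1 : ℝ) 2, ∀ N t : ℝ, 0 < N → N ≠ 1 → t ≠ 0 →
      ∀ g h : Plane → ℂ, Integrable g → Integrable h → Continuous g → Continuous h →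
      Integrable (fun ζ => (starRingEnd ℂ) (𝓕 g ζ) * 𝓕 h ζ) →
      ‖∫ ζ, (starRingEnd ℂ) (𝓕 g ζ) * 𝓕 h ζ *
          regularizedSymbol χ α N t 0 (angularFreq ζ 0) (angularFreq ζ 1)‖ₑ ≤
        ENNReal.ofReal (C * N ^ (-(1 / 3) * (α - 1 / 2)) * |t| ^ (-(5 / 6) : ℝ)) *
          ((∫⁻ z, ‖h z‖ₑ) * ∫⁻ z, ‖g z‖ₑ) := by
  obtain ⟨C, hC0, hC⟩ := hχ.exists_norm_integral_kernelIntegrand_le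
  refine ⟨C, hC0, fun α hα N t hN hN1 ht g h hg hh hgc hhc hgh => ?_⟩
  set W : ℝ → Plane → ℂ := fun δ ζ =>
    regularizedSymbol χ α N t δ (angularFreq ζ 0) (angularFreq ζ 1) with hW
  set J : ℝ → Plane → ℂ := fun δ z =>
    (((2 * Real.pi) ^ 2)⁻¹ : ℝ) • ∫ ξ, kernelIntegrand χ α N t δ (z 0) (z 1) ξ with hJ
  have hpi : (((2 * Real.pi) ^ 2)⁻¹ : ℝ) ≤ 1 := by
    refine inv_le_one_of_one_le₀ (one_le_pow₀ ?_)
    linarith [Real.pi_gt_three]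
  have hpi0 : (0 : ℝ) ≤ ((2 * Real.pi) ^ 2)⁻¹ := by positivity
  have hle : ∀ v : ℂ, ‖(((2 * Real.pi) ^ 2)⁻¹ : ℝ) • v‖ ≤ ‖v‖ := fun v => by
    rw [norm_smul, Real.norm_of_nonneg hpi0]
    exact mul_le_of_le_one_left (norm_nonneg _) hpi
  set E := C * N ^ (-(1 / 3) * (α - 1 / 2)) * |t| ^ (-(5 / 6) : ℝ) with hE
  have hJ0 : ∀ z, ‖J 0 z‖ₑ ≤ ENNReal.ofReal E := fun z => by
    rw [← ofReal_norm]
    exact ENNReal.ofReal_le_ofReal ((hle _).trans (hC α hα N t _ _ hN hN1 ht))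
  -- A crude bound, not of the right size in `t` and `N`; it only dominates the kernels uniformly in
  -- `δ` so that the limit `δ → 0` can be taken. The sharp bound `E` is used at `δ = 0` alone.
  set K := ∫ ξ, dyadicBump χ N ξ ^ 2 * (Real.pi / (|t| * (N / 2))) ^ (1 / 2 : ℝ) with hK
  have hJK : ∀ δ, 0 < δ → ∀ z, ‖J δ z‖ₑ ≤ ENNReal.ofReal K := fun δ hδ z => by
    rw [← ofReal_norm]
    refine ENNReal.ofReal_le_ofReal ((hle _).trans ?_)
    exact norm_integral_le_of_norm_le ((hχ.integrable_dyadicBump_sq hN hN1).mul_const _)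
      (Filter.Eventually.of_forall (hχ.norm_kernelIntegrand_le α _ _ hN hN1 hδ.le ht))
  have hlim1 : Tendsto (fun δ => ∫ ζ, (starRingEnd ℂ) (𝓕 g ζ) * 𝓕 h ζ * W δ ζ) (𝓝[>] 0)
      (𝓝 (∫ ζ, (starRingEnd ℂ) (𝓕 g ζ) * 𝓕 h ζ * W 0 ζ)) := by
    refine tendsto_integral_filter_of_dominated_convergence
      (fun ζ => ‖(starRingEnd ℂ) (𝓕 g ζ) * 𝓕 h ζ‖) ?_ ?_ hgh.norm ?_
    · refine Eventually.of_forall fun δ => hgh.1.mul (Measurable.aestronglyMeasurable ?_)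
      exact hχ.measurable_regularizedSymbol_angularFreq α N t δ
    · filter_upwards [self_mem_nhdsWithin] with δ hδ
      refine Eventually.of_forall fun ζ => ?_
      rw [norm_mul, hW, norm_regularizedSymbol]
      refine mul_le_of_le_one_right (norm_nonneg _) (mul_le_one₀ ?_ (Real.exp_pos _).le ?_)
      · rw [← sq_abs]
        exact pow_le_one₀ (abs_nonneg _) (hχ.abs_dyadicBump_le_one N _)
      · rw [Real.exp_le_one_iff, neg_mul, neg_nonpos]
        exact mul_nonneg (le_of_lt (mem_Ioi.1 hδ)) (sq_nonneg _)
    · refine Eventually.of_forall fun ζ => Tendsto.mul tendsto_const_nhds ?_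
      have : Continuous fun δ : ℝ => W δ ζ :=
        continuous_regularizedSymbol χ α N t _ _
      exact (this.tendsto 0).mono_left nhdsWithin_le_nhds
  have hFJ : ∀ δ, 0 < δ → 𝓕⁻ (W δ) = J δ := fun δ hδ =>
    funext fun z => hχ.fourierInv_regularizedSymbol α t hN hN1 hδ z
  have hJc : ∀ δ, 0 < δ → Continuous (J δ) := fun δ hδ => by
    have : J δ = fun z => 𝓕 (W δ) (-z) := by
      rw [← hFJ δ hδ]; exact funext fun z => Real.fourierInv_eq_fourier_neg _ z
    rw [this]
    exact (continuous_fourier_of_integrable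
      (hχ.integrable_regularizedSymbol_angularFreq α t hN hN1 hδ)).comp continuous_neg
  have hprod : ∫⁻ p : Plane × Plane, ‖h p.1‖ₑ * ‖g p.2‖ₑ = (∫⁻ z, ‖h z‖ₑ) * ∫⁻ z, ‖g z‖ₑ := by
    rw [Measure.volume_eq_prod]
    exact lintegral_prod_mul hhc.measurable.enorm.aemeasurable hgc.measurable.enorm.aemeasurable
  have hfin : (∫⁻ z, ‖h z‖ₑ) * ∫⁻ z, ‖g z‖ₑ ≠ ⊤ := ENNReal.mul_ne_top hh.2.ne hg.2.ne
  have hlim2 : Tendsto (fun δ => ∫⁻ p : Plane × Plane, ‖h p.1‖ₑ * ‖g p.2‖ₑ * ‖J δ (p.2 - p.1)‖ₑ)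
      (𝓝[>] 0) (𝓝 (∫⁻ p : Plane × Plane, ‖h p.1‖ₑ * ‖g p.2‖ₑ * ‖J 0 (p.2 - p.1)‖ₑ)) := by
    refine tendsto_lintegral_filter_of_dominated_convergence
      (fun p => ‖h p.1‖ₑ * ‖g p.2‖ₑ * ENNReal.ofReal K) ?_ ?_ ?_ ?_
    · filter_upwards [self_mem_nhdsWithin] with δ hδ
      have h1 : Measurable fun p : Plane × Plane => J δ (p.2 - p.1) :=
        ((hJc δ hδ).comp (continuous_snd.sub continuous_fst)).measurable
      have h2 : Measurable fun p : Plane × Plane => ‖h p.1‖ₑ :=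
        (hhc.comp continuous_fst).measurable.enorm
      have h3 : Measurable fun p : Plane × Plane => ‖g p.2‖ₑ :=
        (hgc.comp continuous_snd).measurable.enorm
      exact (h2.mul h3).mul h1.enorm
    · filter_upwards [self_mem_nhdsWithin] with δ hδ
      refine Eventually.of_forall fun p => ?_
      gcongr
      exact hJK δ hδ _
    · rw [lintegral_mul_const _ (by fun_prop), hprod]
      exact ENNReal.mul_ne_top hfin ENNReal.ofReal_ne_top
    · refine Eventually.of_forall fun p => ENNReal.Tendsto.const_mul ?_ (Or.inr (by finiteness))
      refine (continuous_enorm.tendsto _).comp ?_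
      exact (hχ.tendsto_integral_kernelIntegrand α _ _ hN hN1 ht).const_smul _
  have hbd : ‖∫ ζ, (starRingEnd ℂ) (𝓕 g ζ) * 𝓕 h ζ * W 0 ζ‖ₑ ≤
      ∫⁻ p : Plane × Plane, ‖h p.1‖ₑ * ‖g p.2‖ₑ * ‖J 0 (p.2 - p.1)‖ₑ := by
    refine le_of_tendsto_of_tendsto ((continuous_enorm.tendsto _).comp hlim1) hlim2 ?_
    filter_upwards [self_mem_nhdsWithin] with δ hδ
    have := enorm_integral_conj_fourier_mul_fourier_mul_le hg hh hgc hhc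
      (hχ.integrable_regularizedSymbol_angularFreq α t hN hN1 (mem_Ioi.1 hδ))
    rw [← hFJ δ hδ]
    exact this
  refine hbd.trans ?_
  calc _ ≤ ∫⁻ p : Plane × Plane, ‖h p.1‖ₑ * ‖g p.2‖ₑ * ENNReal.ofReal E := by
        refine lintegral_mono fun p => ?_
        gcongr
        exact hJ0 _
    _ = _ := by rw [lintegral_mul_const _ (by fun_prop), hprod, mul_comm]

end Cutoff

/-! ### The localized evolution on `L²` -/

lemma fourier_fourierMultiplier (m : Plane → ℂ) (hm : Measurable m) (hb : ∃ C : ℝ, ∀ ζ, ‖m ζ‖ ≤ C)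
    (f : L2Plane) :
    ⇑(𝓕 (fourierMultiplier m hm hb f) : L2Plane) =ᵐ[volume]
      fun ζ => m (angularFreq ζ) * (𝓕 f : L2Plane) ζ := by
  rw [fourierMultiplier, FourierTransform.fourier_fourierInv_eq]
  filter_upwards [Lp.coeFn_lpSMul (r := 2) ((memLp_symbol hm hb).toLp _) (𝓕 f : L2Plane),
    (memLp_symbol hm hb).coeFn_toLp] with ζ h1 h2
  rw [h1, Pi.smul_apply', h2, smul_eq_mul]

section Evolution

variable {χ : ℝ → ℝ} (hχ : IsCutoff χ)

include hχ

lemma IsCutoff.fourier_freqProj_freeEvolution (α N t : ℝ) (f : L2Plane) :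
    ⇑(𝓕 (freqProj hχ N (freeEvolution α t f)) : L2Plane) =ᵐ[volume]
      fun ζ => projSymbol χ N (angularFreq ζ) *
        (evolutionSymbol α t (angularFreq ζ) * (𝓕 f : L2Plane) ζ) := by
  filter_upwards [fourier_fourierMultiplier (projSymbol χ N) (hχ.measurable_projSymbol N)
      (hχ.bounded_projSymbol N) (freeEvolution α t f),
    fourier_fourierMultiplier (evolutionSymbol α t) (measurable_evolutionSymbol α t)
      (bounded_evolutionSymbol α t) f] with ζ h1 h2
  exact h1.trans (congrArg _ h2)

lemma IsCutoff.norm_freqProj_freeEvolution_le (α N t : ℝ) (f : L2Plane) :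
    ‖freqProj hχ N (freeEvolution α t f)‖ ≤ ‖f‖ := by
  rw [← Lp.norm_fourier_eq (freqProj hχ N (freeEvolution α t f)), ← Lp.norm_fourier_eq f]
  refine Lp.norm_le_norm_of_ae_le ?_
  filter_upwards [hχ.fourier_freqProj_freeEvolution α N t f] with ζ h
  rw [h, norm_mul, norm_mul, evolutionSymbol, Complex.norm_exp_I_mul_ofReal, one_mul, projSymbol,
    Complex.norm_real]
  exact mul_le_of_le_one_left (norm_nonneg _) (hχ.abs_dyadicBump_le_one N _)

/-- Plancherel together with the group law of the evolution symbols. The projection occurs on both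
sides, which is why the dispersive estimate concerns `P_N²`. -/
lemma IsCutoff.inner_freqProj_freqProj (α N s t : ℝ) (f g : L2Plane) :
    inner ℂ (freqProj hχ N (freeEvolution α s f)) (freqProj hχ N (freeEvolution α t g)) =
      ∫ ζ, (starRingEnd ℂ) ((𝓕 f : L2Plane) ζ) * (𝓕 g : L2Plane) ζ *
        regularizedSymbol χ α N (t - s) 0 (angularFreq ζ 0) (angularFreq ζ 1) := by
  rw [← Lp.inner_fourier_eq, L2.inner_def]
  refine integral_congr_ae ?_
  filter_upwards [hχ.fourier_freqProj_freeEvolution α N s f,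
    hχ.fourier_freqProj_freeEvolution α N t g] with ζ h1 h2
  rw [h1, h2, RCLike.inner_apply', map_mul, map_mul]
  have e1 : (starRingEnd ℂ) (evolutionSymbol α s (angularFreq ζ)) *
      evolutionSymbol α t (angularFreq ζ) = evolutionSymbol α (t - s) (angularFreq ζ) := by
    simp only [evolutionSymbol]
    rw [← Complex.exp_conj, ← Complex.exp_add, map_mul, Complex.conj_I, Complex.conj_ofReal]
    congr 1
    push_cast
    ring
  have e2 : regularizedSymbol χ α N (t - s) 0 (angularFreq ζ 0) (angularFreq ζ 1) =
      projSymbol χ N (angularFreq ζ) ^ 2 * evolutionSymbol α (t - s) (angularFreq ζ) := by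
    simp [regularizedSymbol, projSymbol, evolutionSymbol, dispersion]
  have e3 : (starRingEnd ℂ) (projSymbol χ N (angularFreq ζ)) = projSymbol χ N (angularFreq ζ) := by
    rw [projSymbol, Complex.conj_ofReal]
  rw [e2, ← e1, e3]
  ring

/-- The symbol of `P_N` is real and that of `U(t)` is conjugated by `t ↦ -t`. Hence pairing the
solution with a test function is pairing the data with a curve in `L²`, as `TT*` requires. -/
lemma IsCutoff.inner_freqProj_right (α N t : ℝ) (f g : L2Plane) :
    inner ℂ f (freqProj hχ N (freeEvolution α t g)) =
      inner ℂ (freqProj hχ N (freeEvolution α (-t) f)) g := by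
  rw [← Lp.inner_fourier_eq, ← Lp.inner_fourier_eq (freqProj hχ N (freeEvolution α (-t) f)),
    L2.inner_def, L2.inner_def]
  refine integral_congr_ae ?_
  filter_upwards [hχ.fourier_freqProj_freeEvolution α N (-t) f,
    hχ.fourier_freqProj_freeEvolution α N t g] with ζ h1 h2
  rw [h1, h2, RCLike.inner_apply', RCLike.inner_apply', map_mul, map_mul]
  have e1 : (starRingEnd ℂ) (evolutionSymbol α (-t) (angularFreq ζ)) =
      evolutionSymbol α t (angularFreq ζ) := by
    simp only [evolutionSymbol]
    rw [← Complex.exp_conj, map_mul, Complex.conj_I, Complex.conj_ofReal]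
    congr 1
    push_cast
    ring
  have e3 : (starRingEnd ℂ) (projSymbol χ N (angularFreq ζ)) = projSymbol χ N (angularFreq ζ) := by
    rw [projSymbol, Complex.conj_ofReal]
  rw [e1, e3]
  ring

lemma IsCutoff.norm_regularizedSymbol_zero_le_one (α N t ξ μ : ℝ) :
    ‖regularizedSymbol χ α N t 0 ξ μ‖ ≤ 1 := by
  rw [norm_regularizedSymbol, neg_zero, zero_mul, Real.exp_zero, mul_one, ← sq_abs]
  exact pow_le_one₀ (abs_nonneg _) (hχ.abs_dyadicBump_le_one N _)

lemma IsCutoff.continuous_freqProj_freeEvolution (α N : ℝ) (f : L2Plane) :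
    Continuous fun t => freqProj hχ N (freeEvolution α t f) := by
  set V : ℝ → L2Plane := fun t => freqProj hχ N (freeEvolution α t f) with hV
  set k : ℝ → ℂ := fun r => ∫ ζ, (starRingEnd ℂ) ((𝓕 f : L2Plane) ζ) * (𝓕 f : L2Plane) ζ *
        regularizedSymbol χ α N r 0 (angularFreq ζ 0) (angularFreq ζ 1) with hk
  have hi : Integrable fun ζ => (starRingEnd ℂ) ((𝓕 f : L2Plane) ζ) * (𝓕 f : L2Plane) ζ := by
    have := L2.integrable_inner (𝕜 := ℂ) (𝓕 f : L2Plane) (𝓕 f : L2Plane)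
    simpa only [RCLike.inner_apply'] using this
  have hkc : Continuous k := by
    refine continuous_of_dominated
      (bound := fun ζ => ‖(starRingEnd ℂ) ((𝓕 f : L2Plane) ζ) * (𝓕 f : L2Plane) ζ‖)
      (fun r => hi.1.mul (hχ.measurable_regularizedSymbol_angularFreq α N r 0).aestronglyMeasurable)
      (fun r => Filter.Eventually.of_forall fun ζ => ?_) hi.norm
      (Filter.Eventually.of_forall fun ζ => continuous_const.mul ?_)
    · rw [norm_mul]
      exact mul_le_of_le_one_right (norm_nonneg _) (hχ.norm_regularizedSymbol_zero_le_one α N r _ _)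
    · unfold regularizedSymbol
      fun_prop
  have hin : ∀ s t, inner ℂ (V s) (V t) = k (t - s) := fun s t =>
    hχ.inner_freqProj_freqProj α N s t f f
  -- All inner products depend on the time difference only, so norm continuity of the orbit reduces
  -- to continuity of the scalar function `k` at 0.
  have hsq : ∀ s t, ‖V s - V t‖ ^ 2 = (k 0 - k (t - s) - k (s - t) + k 0).re := by
    intro s t
    have := inner_self_eq_norm_sq_to_K (𝕜 := ℂ) (V s - V t)
    rw [inner_sub_left, inner_sub_right, inner_sub_right, hin, hin, hin, hin, sub_self,
      sub_self] at this
    have h2 := congrArg Complex.re this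
    rw [← RCLike.ofReal_pow] at h2
    simp only [Complex.coe_algebraMap, Complex.ofReal_re] at h2
    rw [← h2]
    simp only [Complex.sub_re, Complex.add_re]
    ring
  refine continuous_iff_continuousAt.2 fun t => ?_
  rw [ContinuousAt, tendsto_iff_norm_sub_tendsto_zero]
  have h1 : Filter.Tendsto (fun s => ‖V s - V t‖ ^ 2) (nhds t) (nhds 0) := by
    simp_rw [hsq]
    have : Continuous fun s => (k 0 - k (t - s) - k (s - t) + k 0).re := by fun_prop
    have h := this.tendsto t
    simpa using h
  have h2 := (Real.continuous_sqrt.tendsto 0).comp h1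
  simpa [Function.comp_def, Real.sqrt_sq, norm_nonneg] using h2

lemma IsCutoff.exists_inner_freqProj_le :
    ∃ C : ℝ, 0 < C ∧ ∀ α ∈ Icc (1 : ℝ) 2, ∀ N : ℝ, 0 < N → N ≠ 1 → ∀ s t : ℝ, s ≠ t →
      ∀ g h : SchwartzMap Plane ℂ, ∫⁻ z, ‖g z‖ₑ ≤ 1 → ∫⁻ z, ‖h z‖ₑ ≤ 1 →
      ‖inner ℂ (freqProj hχ N (freeEvolution α (-s) (g.toLp 2)))
          (freqProj hχ N (freeEvolution α (-t) (h.toLp 2)))‖ₑ ≤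
        ENNReal.ofReal (C * N ^ (-(1 / 3) * (α - 1 / 2))) * rieszKernel (s - t) := by
  obtain ⟨C, hC0, hC⟩ := hχ.exists_dispersive_bound
  refine ⟨C, hC0, fun α hα N hN hN1 s t hst g h hg hh => ?_⟩
  have hcoe : ∀ f : SchwartzMap Plane ℂ, ⇑(𝓕 (f.toLp 2) : L2Plane) =ᵐ[volume] 𝓕 (f : Plane → ℂ) := by
    intro f
    rw [SchwartzMap.toLp_fourier_eq]
    filter_upwards [(𝓕 f).coeFn_toLp 2 volume] with ζ hζ
    rw [hζ, SchwartzMap.fourier_coe]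
  have hi : Integrable fun ζ =>
      (starRingEnd ℂ) (𝓕 (g : Plane → ℂ) ζ) * 𝓕 (h : Plane → ℂ) ζ := by
    have := L2.integrable_inner (𝕜 := ℂ) (𝓕 (g.toLp 2) : L2Plane) (𝓕 (h.toLp 2) : L2Plane)
    refine this.congr ?_
    filter_upwards [hcoe g, hcoe h] with ζ h1 h2
    rw [h1, h2, RCLike.inner_apply']
  have key := hC α hα N (s - t) hN hN1 (sub_ne_zero.2 hst) g h g.integrable h.integrable
    g.continuous h.continuous hi
  rw [hχ.inner_freqProj_freqProj]
  have e : -t - -s = s - t := by ring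
  rw [e]
  have e2 : ∫ ζ, (starRingEnd ℂ) ((𝓕 (g.toLp 2) : L2Plane) ζ) * (𝓕 (h.toLp 2) : L2Plane) ζ *
        regularizedSymbol χ α N (s - t) 0 (angularFreq ζ 0) (angularFreq ζ 1) =
      ∫ ζ, (starRingEnd ℂ) (𝓕 (g : Plane → ℂ) ζ) * 𝓕 (h : Plane → ℂ) ζ *
        regularizedSymbol χ α N (s - t) 0 (angularFreq ζ 0) (angularFreq ζ 1) := by
    refine integral_congr_ae ?_
    filter_upwards [hcoe g, hcoe h] with ζ h1 h2
    rw [h1, h2]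
  rw [e2]
  refine key.trans ?_
  rw [rieszKernel, ← ENNReal.ofReal_mul (by positivity)]
  calc _ ≤ ENNReal.ofReal (C * N ^ (-(1 / 3) * (α - 1 / 2)) * |s - t| ^ (-(5 / 6) : ℝ)) * (1 * 1) := by
        gcongr
    _ = _ := by rw [mul_one, mul_one]

end Evolution

/-! ### Detecting the `L^∞` norm and interpolating in space -/

/-- Suprema of `‖⟪f, u⟫‖` over a nonempty set can be computed along a sequence. -/
lemma exists_seq_enorm_inner_le_iSup {H : Type*} [NormedAddCommGroup H] [InnerProductSpace ℂ H]
    [SecondCountableTopology H] {S : Set H} (hS : S.Nonempty) :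
    ∃ v : ℕ → H, (∀ k, v k ∈ S) ∧
      ∀ f ∈ S, ∀ u : H, ‖inner ℂ f u‖ₑ ≤ ⨆ k, ‖inner ℂ (v k) u‖ₑ := by
  have : Nonempty S := hS.to_subtype
  refine ⟨fun k => TopologicalSpace.denseSeq S k, fun k => (TopologicalSpace.denseSeq S k).2,
    fun f hf u => ?_⟩
  have hc : Continuous fun f : S => ‖inner ℂ (f : H) u‖ₑ := by fun_prop
  have hcl : IsClosed {f : S | ‖inner ℂ (f : H) u‖ₑ ≤
      ⨆ k, ‖inner ℂ (TopologicalSpace.denseSeq S k : H) u‖ₑ} := isClosed_le hc continuous_const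
  have hsub : range (TopologicalSpace.denseSeq S) ⊆ {f : S | ‖inner ℂ (f : H) u‖ₑ ≤
      ⨆ k, ‖inner ℂ (TopologicalSpace.denseSeq S k : H) u‖ₑ} := by
    rintro _ ⟨k, rfl⟩
    exact le_iSup (fun k => ‖inner ℂ (TopologicalSpace.denseSeq S k : H) u‖ₑ) k
  exact closure_minimal hsub hcl (TopologicalSpace.denseRange_denseSeq S ⟨f, hf⟩)

/-- Countably many Schwartz functions in the unit ball of `L¹` detect the `L^∞` norm. -/
lemma exists_schwartz_seq_eLpNorm_top_le :
    ∃ G : ℕ → SchwartzMap Plane ℂ, (∀ k, ∫⁻ z, ‖G k z‖ₑ ≤ 1) ∧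
      ∀ u : L2Plane, eLpNorm u ⊤ volume ≤ ⨆ k, ‖inner ℂ ((G k).toLp 2 : L2Plane) u‖ₑ := by
  set S : Set L2Plane := {f | ∃ g : SchwartzMap Plane ℂ, ∫⁻ z, ‖g z‖ₑ ≤ 1 ∧ g.toLp 2 = f} with hS
  have hne : S.Nonempty := ⟨(0 : SchwartzMap Plane ℂ).toLp 2, 0, by simp, rfl⟩
  have : Fact ((2 : ℝ≥0∞) ≠ ⊤) := ⟨ENNReal.ofNat_ne_top⟩
  have hsc : SecondCountableTopology L2Plane := Lp.SecondCountableTopology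
  obtain ⟨v, hv, hvs⟩ := exists_seq_enorm_inner_le_iSup hne
  choose G hG1 hG2 using hv
  refine ⟨G, hG1, fun u => ?_⟩
  simp_rw [hG2]
  set M := ⨆ k, ‖inner ℂ (v k) u‖ₑ with hM
  have hall : ∀ g : SchwartzMap Plane ℂ, ∫⁻ z, ‖g z‖ₑ ≤ 1 →
      ‖inner ℂ (g.toLp 2 : L2Plane) u‖ₑ ≤ M := fun g hg => hvs _ ⟨g, hg, rfl⟩ u
  -- Mollifiers with shrinking supports. Almost every value of `u` is a limit of its pairings with
  -- translated bumps of integral 1, which are admissible test functions.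
  set b : ℕ → ContDiffBump (0 : Plane) := fun n =>
    ⟨1 / (n + 1), 2 / (n + 1), by positivity, by gcongr; norm_num⟩ with hb
  have hlim := ContDiffBump.ae_convolution_tendsto_right_of_locallyIntegrable (φ := b)
    (l := Filter.atTop) (K := 2) (g := (u : Plane → ℂ)) (μ := volume)
    (by
      simp only [hb]
      simpa [div_eq_mul_inv] using
        (tendsto_one_div_add_atTop_nhds_zero_nat (𝕜 := ℝ)).const_mul 2)
    (Filter.Eventually.of_forall fun n => by simp only [hb]; rw [mul_one_div])
    ((Lp.memLp u).locallyIntegrable (by norm_num))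
  rw [eLpNorm_exponent_top]
  refine eLpNormEssSup_le_of_ae_enorm_bound ?_
  filter_upwards [hlim] with x hx
  refine le_of_tendsto ((continuous_enorm.tendsto _).comp hx) (Filter.Eventually.of_forall fun n => ?_)
  set ρ : Plane → ℂ := fun z => (((b n).normed volume (x - z) : ℝ) : ℂ) with hρ
  have hρs : ContDiff ℝ ∞ ρ :=
    Complex.ofRealCLM.contDiff.comp ((b n).contDiff_normed.comp (contDiff_const.sub contDiff_id))
  have hρc : HasCompactSupport ρ := by
    have h1 : HasCompactSupport fun z => (b n).normed volume (x - z) :=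
      (b n).hasCompactSupport_normed.comp_homeomorph (Homeomorph.subLeft x)
    exact h1.comp_left (g := fun r : ℝ => (r : ℂ)) (by simp)
  set g := hρc.toSchwartzMap hρs with hg
  have hgρ : ∀ z, g z = ρ z := fun z => rfl
  have hg1 : ∫⁻ z, ‖g z‖ₑ ≤ 1 := by
    have e : ∀ z, ‖g z‖ₑ = ENNReal.ofReal ((b n).normed volume (x - z)) := fun z => by
      rw [hgρ, hρ, ← ofReal_norm, Complex.norm_real, Real.norm_of_nonneg ((b n).nonneg_normed _)]
    simp_rw [e]
    rw [lintegral_sub_left_eq_self (fun z => ENNReal.ofReal ((b n).normed volume z)) x,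
      ← ofReal_integral_eq_lintegral_ofReal (b n).integrable_normed
      (Filter.Eventually.of_forall (b n).nonneg_normed), (b n).integral_normed]
    simp
  refine le_trans (le_of_eq ?_) (hall g hg1)
  simp only [Function.comp]
  congr 1
  rw [L2.inner_def, convolution_def, ← integral_sub_left_eq_self _ volume x]
  refine integral_congr_ae ?_
  filter_upwards [g.coeFn_toLp 2 volume] with z hz
  rw [hz, RCLike.inner_apply', hgρ, hρ, Complex.conj_ofReal, sub_sub_cancel]
  simp

/-- Log-convexity of the `L^p` norms between `L²` and `L^∞`. -/
lemma eLpNorm_le_eLpNorm_two_mul_eLpNorm_top {f : Plane → ℂ} (hf : AEStronglyMeasurable f volume)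
    {θ : ℝ} (hθ : θ ∈ Icc (0 : ℝ) 1) {p : ℝ≥0∞} (hp : p⁻¹ = ENNReal.ofReal ((1 - θ) / 2)) :
    eLpNorm f p volume ≤ eLpNorm f 2 volume ^ (1 - θ) * eLpNorm f ⊤ volume ^ θ := by
  rcases eq_or_lt_of_le hθ.2 with h1 | h1
  · subst h1
    have : p = ⊤ := by simpa using hp
    rw [this]
    simp
  have hp' : p = ENNReal.ofReal (2 / (1 - θ)) := by
    rw [← inv_inv p, hp, ← ENNReal.ofReal_inv_of_pos (by linarith), inv_div]
  have h1θ : 0 < 1 - θ := by linarith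
  have hpr : 0 < 2 / (1 - θ) := by positivity
  -- Two powers of `|f|` are kept for the `L²` norm and the surplus is bounded by the essential
  -- supremum.
  have hq : 2 / (1 - θ) = 2 + 2 * θ / (1 - θ) := by field_simp; ring
  have hq0 : 0 ≤ 2 * θ / (1 - θ) := div_nonneg (by linarith [hθ.1]) h1θ.le
  rw [eLpNorm_eq_lintegral_rpow_enorm_toReal (by rw [hp']; simpa using hpr)
    (by rw [hp']; exact ENNReal.ofReal_ne_top), hp', ENNReal.toReal_ofReal hpr.le,
    eLpNorm_eq_lintegral_rpow_enorm_toReal (by norm_num) (by norm_num), ENNReal.toReal_ofNat]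
  have hpt : ∫⁻ z, ‖f z‖ₑ ^ (2 / (1 - θ)) ≤
      (∫⁻ z, ‖f z‖ₑ ^ (2 : ℝ)) * eLpNorm f ⊤ volume ^ (2 * θ / (1 - θ)) := by
    rw [← lintegral_mul_const'' _ (hf.enorm.pow_const _)]
    refine lintegral_mono_ae ?_
    filter_upwards [ae_le_eLpNormEssSup (f := f) (μ := volume)] with z hz
    rw [hq, ENNReal.rpow_add_of_nonneg _ _ (by norm_num) hq0, eLpNorm_exponent_top]
    gcongr
  calc _ ≤ ((∫⁻ z, ‖f z‖ₑ ^ (2 : ℝ)) * eLpNorm f ⊤ volume ^ (2 * θ / (1 - θ))) ^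
        (1 / (2 / (1 - θ))) := ENNReal.rpow_le_rpow hpt (by positivity)
    _ = _ := by
      rw [ENNReal.mul_rpow_of_nonneg _ _ (by positivity), ← ENNReal.rpow_mul, ← ENNReal.rpow_mul]
      congr 2 <;> field_simp

/-- The endpoint Strichartz estimate, tested against countably many functions. -/
lemma lintegral_iSup_inner_freqProj_le {χ : ℝ → ℝ} (hχ : IsCutoff χ) (α N : ℝ) {G : ℕ → L2Plane}
    {D : ℝ≥0∞}
    (hD : ∀ k l t s, t ≠ s →
      ‖inner ℂ (freqProj hχ N (freeEvolution α (-t) (G k)))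
        (freqProj hχ N (freeEvolution α (-s) (G l)))‖ₑ ≤ D * rieszKernel (t - s)) (φ : L2Plane) :
    ∫⁻ t, (⨆ k, ‖inner ℂ (G k) (freqProj hχ N (freeEvolution α t φ))‖ₑ) ^ (12 / 5 : ℝ) ≤
      ((28 * D) ^ (1 / 2 : ℝ) * ‖φ‖ₑ) ^ (12 / 5 : ℝ) := by
  have : Fact ((2 : ℝ≥0∞) ≠ ⊤) := ⟨ENNReal.ofNat_ne_top⟩
  have hsc : SecondCountableTopology L2Plane := Lp.SecondCountableTopology
  have key := lintegral_iSup_inner_rpow_le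
    (V := fun k t => freqProj hχ N (freeEvolution α (-t) (G k))) (B := fun k => ‖G k‖)
    (fun k => (hχ.continuous_freqProj_freeEvolution α N (G k)).comp continuous_neg)
    (fun k t => hχ.norm_freqProj_freeEvolution_le α N (-t) (G k)) hD φ
  simp only [hχ.inner_freqProj_right α N _ (G _) φ]
  exact key

end

/-! ### Conclusion -/

theorem proposition3p5 (α : ℝ) (hα : α ∈ Icc (1 : ℝ) 2) (χ : ℝ → ℝ) (hχ : IsCutoff χ) :
    ∃ C : ℝ, 0 < C ∧
      ∀ N ∈ dyadicNumbers, ∀ θ ∈ Icc (0 : ℝ) 1, (N = 1 → θ = 0) →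
        ∀ p q : ℝ≥0∞, q⁻¹ = ENNReal.ofReal (5 * θ / 12) → p⁻¹ = ENNReal.ofReal ((1 - θ) / 2) →
          ∀ φ : L2Plane,
            mixedNorm q p (fun t : ℝ => freqProj hχ N (freeEvolution α t φ)) ≤
              ENNReal.ofReal (C * N ^ (-(θ / 6) * (α - 1 / 2))) * ‖φ‖ₑ := by
  obtain ⟨C, hC0, hC⟩ := hχ.exists_inner_freqProj_le
  obtain ⟨G, hG1, hG⟩ := exists_schwartz_seq_eLpNorm_top_le
  -- The constant must dominate `(28 C)^(θ/2)` for every `θ`. A base of at least 1 makes this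
  -- monotone in the exponent, and also covers the `L²` bound at `θ = 0`.
  refine ⟨max 1 (28 * C), lt_max_of_lt_left one_pos, ?_⟩
  intro N hN θ hθ hNθ p q hq hp φ
  have hN1 : 1 ≤ N := by
    obtain ⟨l, rfl⟩ := hN
    exact one_le_pow₀ (by norm_num)
  have hN0 : 0 < N := by linarith
  set u : ℝ → L2Plane := fun t => freqProj hχ N (freeEvolution α t φ) with hu
  have hu2 : ∀ t, eLpNorm (u t) 2 volume ≤ ‖φ‖ₑ := fun t => by
    rw [← Lp.enorm_def, ← ofReal_norm, ← ofReal_norm]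
    exact ENNReal.ofReal_le_ofReal (hχ.norm_freqProj_freeEvolution_le α N t φ)
  have hinterp : ∀ t, eLpNorm (u t) p volume ≤
      ‖φ‖ₑ ^ (1 - θ) * eLpNorm (u t) ⊤ volume ^ θ := fun t =>
    (eLpNorm_le_eLpNorm_two_mul_eLpNorm_top (Lp.aestronglyMeasurable (u t)) hθ hp).trans
      (mul_le_mul_left (ENNReal.rpow_le_rpow (hu2 t) (by linarith [hθ.2])) _)
  rw [mixedNorm]
  rcases eq_or_lt_of_le hθ.1 with h0 | h0
  · subst h0
    have hqt : q = ⊤ := by simpa using hq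
    simp only [sub_zero, ENNReal.rpow_one, ENNReal.rpow_zero, mul_one] at hinterp
    rw [hqt, eLpNorm_exponent_top]
    refine eLpNormEssSup_le_of_ae_enorm_bound (Filter.Eventually.of_forall fun t => ?_)
    rw [enorm_eq_self]
    refine (hinterp t).trans ?_
    rw [zero_div, neg_zero, zero_mul, Real.rpow_zero, mul_one]
    exact le_mul_of_one_le_left zero_le (ENNReal.one_le_ofReal.2 (le_max_left _ _))
  have hNne : N ≠ 1 := fun h => h0.ne' (hNθ h)
  set D := ENNReal.ofReal (C * N ^ (-(1 / 3) * (α - 1 / 2))) with hD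
  have hmain : ∫⁻ t, eLpNorm (u t) ⊤ volume ^ (12 / 5 : ℝ) ≤
      ((28 * D) ^ (1 / 2 : ℝ) * ‖φ‖ₑ) ^ (12 / 5 : ℝ) :=
    (lintegral_mono fun t => ENNReal.rpow_le_rpow (hG (u t)) (by norm_num)).trans
      (lintegral_iSup_inner_freqProj_le hχ α N
        (fun k l t s hts => hC α hα N hN0 hNne t s hts (G k) (G l) (hG1 k) (hG1 l)) φ)
  have hqr : 0 < 12 / (5 * θ) := by positivity
  have hq' : q = ENNReal.ofReal (12 / (5 * θ)) := by
    rw [← inv_inv q, hq, ← ENNReal.ofReal_inv_of_pos (by positivity), inv_div]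
  rw [eLpNorm_eq_lintegral_rpow_enorm_toReal (by rw [hq']; simpa using hqr)
    (by rw [hq']; exact ENNReal.ofReal_ne_top), hq', ENNReal.toReal_ofReal hqr.le]
  have hθ1 : 0 ≤ 1 - θ := by linarith [hθ.2]
  have hfin : (‖φ‖ₑ ^ (1 - θ)) ^ (12 / (5 * θ)) ≠ ⊤ :=
    ENNReal.rpow_ne_top_of_nonneg hqr.le (ENNReal.rpow_ne_top_of_nonneg hθ1 enorm_ne_top)
  -- Because `q θ = 12/5`, the `q`-th power of the fixed-time interpolation bound contains exactly
  -- the `12/5`-th power of the `L^∞` norm, and the `L²` factor is constant in time.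
  have hint : ∫⁻ t, ‖eLpNorm (u t) p volume‖ₑ ^ (12 / (5 * θ)) ≤
      (‖φ‖ₑ ^ (1 - θ)) ^ (12 / (5 * θ)) * ((28 * D) ^ (1 / 2 : ℝ) * ‖φ‖ₑ) ^ (12 / 5 : ℝ) := by
    calc _ ≤ ∫⁻ t, (‖φ‖ₑ ^ (1 - θ)) ^ (12 / (5 * θ)) *
          eLpNorm (u t) ⊤ volume ^ (12 / 5 : ℝ) := by
          refine lintegral_mono fun t => ?_
          rw [enorm_eq_self]
          refine (ENNReal.rpow_le_rpow (hinterp t) hqr.le).trans (le_of_eq ?_)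
          rw [ENNReal.mul_rpow_of_nonneg _ _ hqr.le, ← ENNReal.rpow_mul _ θ]
          congr 2
          field_simp
      _ ≤ _ := by
          rw [lintegral_const_mul' _ _ hfin]
          gcongr
  have hconst : (28 * D) ^ (θ / 2) ≤
      ENNReal.ofReal (max 1 (28 * C) * N ^ (-(θ / 6) * (α - 1 / 2))) := by
    have hE : 0 ≤ N ^ (-(1 / 3) * (α - 1 / 2)) := by positivity
    rw [hD, ← ENNReal.ofReal_ofNat 28, ← ENNReal.ofReal_mul (by norm_num),
      ENNReal.ofReal_rpow_of_nonneg (by positivity) (by positivity)]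
    refine ENNReal.ofReal_le_ofReal ?_
    rw [← mul_assoc, Real.mul_rpow (by positivity) hE, ← Real.rpow_mul hN0.le]
    have e1 : -(1 / 3) * (α - 1 / 2) * (θ / 2) = -(θ / 6) * (α - 1 / 2) := by ring
    rw [e1]
    refine mul_le_mul_of_nonneg_right ?_ (by positivity)
    calc (28 * C) ^ (θ / 2) ≤ (max 1 (28 * C)) ^ (θ / 2) :=
          Real.rpow_le_rpow (by positivity) (le_max_right _ _) (by positivity)
      _ ≤ (max 1 (28 * C)) ^ (1 : ℝ) :=
          Real.rpow_le_rpow_of_exponent_le (le_max_left _ _) (by linarith [hθ.2])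
      _ = _ := Real.rpow_one _
  calc _ ≤ ((‖φ‖ₑ ^ (1 - θ)) ^ (12 / (5 * θ)) *
        ((28 * D) ^ (1 / 2 : ℝ) * ‖φ‖ₑ) ^ (12 / 5 : ℝ)) ^ (1 / (12 / (5 * θ))) :=
        ENNReal.rpow_le_rpow hint (by positivity)
    _ = (28 * D) ^ (θ / 2) * ‖φ‖ₑ := by
        rw [ENNReal.mul_rpow_of_nonneg _ _ (by positivity), ← ENNReal.rpow_mul,
          ← ENNReal.rpow_mul ((28 * D) ^ (1 / 2 : ℝ) * ‖φ‖ₑ), mul_one_div_cancel hqr.ne',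
          ENNReal.rpow_one]
        have e2 : (12 / 5 : ℝ) * (1 / (12 / (5 * θ))) = θ := by field_simp
        rw [e2, ENNReal.mul_rpow_of_nonneg _ _ h0.le, ← ENNReal.rpow_mul, mul_left_comm,
          ← ENNReal.rpow_add_of_nonneg _ _ hθ1 h0.le]
        congr 1
        · congr 1; ring
        · rw [sub_add_cancel, ENNReal.rpow_one]
    _ ≤ _ := by gcongr
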